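/- **Conventions.** Let $d_1,d_2,d_3$ be natural numbers. Five tripartite orthogonal product states (OPSs) are normalised, mutually orthogonal product states $|\psi_j\rangle=|\varphi_{1,j}\rangle\otimes|\varphi_{2,j}\rangle\otimes|\varphi_{3,j}\rangle\in\mathbb C^{d_1}\otimes\mathbb C^{d_2}\otimes\mathbb C^{d_3}$, $j=1,\dots,5$. Their orthogonality graph has vertices $1,\dots,5$ and an edge of colour $i$ between $j\neq k$ whenever $\langle\varphi_{i,j}|\varphi_{i,k}\rangle=0$; their orthogonality vector is $(a,b,c)$ when there are $a$, $b$, $c$ edges of colour $1$, $2$, $3$. Graphs are identified up to relabelling the vertices (keeping the colours). The states can be perfectly distinguished by LOCC if some finite protocol, in which at each step one party (depending on all earlier outcomes) performs a measurement $\{M_o\}$, $\sum_o M_o^\dagger M_o=I$, with finitely many outcomes on its own subsystem and announces the outcome, identifies each of the five states with probability $1$. Let $G_{26}$ be the coloured graph with colour classes $$\{12,35,24,34,45\},\quad \{13,25,14\},\quad \{15,23\}$$ (state 4 is joined to $2,3,5$ in colour 1 and to $1$ in colour 2, and on $\{1,2,3,5\}$ each colour is a perfect matching), and let $G_{30}$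 be the one with colour classes $$\{14,34,23,25,15\},\quad \{12,13,45\},\quad\{24,35\}.$$ **Theorem 10.** 1. Up to relabelling there are exactly 30 orthogonality graphs of five tripartite OPSs with orthogonality vector $(5,3,2)$, and $G_{26}$ and $G_{30}$ are two different ones among them. 2. For all $d_1,d_2,d_3$, every five tripartite OPSs in $\mathbb C^{d_1}\otimes\mathbb C^{d_2}\otimes\mathbb C^{d_3}$ with orthogonality vector $(5,3,2)$ whose orthogonality graph is neither $G_{26}$ nor $G_{30}$ can be perfectly distinguished by LOCC. 3. There are five tripartite OPSs with orthogonality vector $(5,3,2)$ and orthogonality graph $G_{26}$ that cannot be perfectly distinguished by LOCC. 4. The five states in $\mathbb C^3\otimes\mathbb C^2\otimes\mathbb C^2$ $$|0\rangle|0\rangle\Big(\tfrac1{\sqrt3}|0\rangle+\sqrt{\tfrac23}|1\rangle\Big),\quad \tfrac1{\sqrt6}|0+1-2\rangle|1\rangle|0+1\rangle,\quad \tfrac1{\sqrt2}|0+2\rangle|1\rangle|0\rangle,\quad \tfrac12|1\rangle|0+1\rangle|0-1\rangle,\quad \tfrac12|1+2\rangle|0-1\rangle|1\rangle$$ are OPSs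 with orthogonality vector $(5,3,2)$ and orthogonality graph $G_{30}$, and they cannot be perfectly distinguished by LOCC. The five states in $\mathbb C^3\otimes\mathbb C^2\otimes\mathbb C^3$ $$|0\rangle|0\rangle|0\rangle,\quad \tfrac1{\sqrt6}|0+1-2\rangle|1\rangle|0+1\rangle,\quad \tfrac12|0+2\rangle|1\rangle|0+2\rangle,\quad \tfrac12|1\rangle|0+1\rangle|0-1\rangle,\quad \tfrac1{2\sqrt2}|1+2\rangle|0-1\rangle|0-2\rangle$$ are OPSs with orthogonality vector $(5,3,2)$ and orthogonality graph $G_{30}$, and they can be perfectly distinguished by LOCC. (Here $|0+1-2\rangle$ means $|0\rangle+|1\rangle-|2\rangle$, and so on.) -/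

import Mathlib

open scoped Matrix

noncomputable section

namespace LocalDiscrimination

/-- Pure (not necessarily normalised) states of `ℂ^(d 0) ⊗ ⋯ ⊗ ℂ^(d (m-1))`, given by their
coefficients in the computational basis. -/
abbrev Ket {m : ℕ} (d : Fin m → ℕ) : Type :=
  EuclideanSpace ℂ ((i : Fin m) → Fin (d i))

/-- A family of `n` lists of local vectors: `φ j i` is the `i`-th tensor factor of state `j`. -/
abbrev LocalVectors {m : ℕ} (d : Fin m → ℕ) (n : ℕ) : Type :=
  Fin n → (i : Fin m) → EuclideanSpace ℂ (Fin (d i))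

/-- The product state `φ 0 ⊗ ⋯ ⊗ φ (m-1)`. -/
def productKet {m : ℕ} {d : Fin m → ℕ} (φ : (i : Fin m) → EuclideanSpace ℂ (Fin (d i))) :
    Ket d :=
  WithLp.toLp 2 fun x => ∏ i, φ i (x i)

/-- The product states with local vectors `φ` are normalised and mutually orthogonal. -/
structure IsOPS {m n : ℕ} {d : Fin m → ℕ} (φ : LocalVectors d n) : Prop where
  norm_eq_one : ∀ j i, ‖φ j i‖ = 1
  orthogonal : ∀ j k, j ≠ k → inner ℂ (productKet (φ j)) (productKet (φ k)) = 0

/-- A graph on `n` labelled vertices whose edges carry colours in `Fin m` (an edge may carry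
several colours): the graph of edges of each colour. -/
abbrev ColoredGraph (m n : ℕ) : Type := Fin m → SimpleGraph (Fin n)

/-- Two coloured graphs agree up to a relabelling of the vertices (colours are kept). -/
def ColoredGraph.Isomorphic {m n : ℕ} (G G' : ColoredGraph m n) : Prop :=
  ∃ σ : Equiv.Perm (Fin n), ∀ i j k, (G i).Adj j k ↔ (G' i).Adj (σ j) (σ k)

/-- The orthogonality graph: states `j`, `k` are joined by an edge of colour `i` when they are
orthogonal on subsystem `i`. -/
def orthGraph {m n : ℕ} {d : Fin m → ℕ} (φ : LocalVectors d n) : ColoredGraph m n := fun i =>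
  { Adj := fun j k => j ≠ k ∧ inner ℂ (φ j i) (φ k i) = 0
    symm := ⟨fun _ _ h => ⟨h.1.symm, inner_eq_zero_symm.1 h.2⟩⟩
    loopless := ⟨fun _ h => h.1 rfl⟩ }

/-- The vector of the numbers of pairwise orthogonal relations on the subsystems. -/
def orthVector {m n : ℕ} {d : Fin m → ℕ} (φ : LocalVectors d n) : Fin m → ℕ :=
  fun i => (orthGraph φ i).edgeSet.ncard

/-- `G` is the orthogonality graph of some orthogonal product states whose vector of the numbers
of pairwise orthogonal relations is `v`. -/
def IsOrthGraphWithVector {m n : ℕ} (G : ColoredGraph m n) (v : Fin m → ℕ) : Prop :=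
  ∃ (d : Fin m → ℕ) (φ : LocalVectors d n), IsOPS φ ∧ orthVector φ = v ∧ orthGraph φ = G

/-- The operator `I ⊗ ⋯ ⊗ M ⊗ ⋯ ⊗ I`, with `M` at party `p`, applied to `ψ`. -/
def applyLocal {m : ℕ} {d : Fin m → ℕ} (p : Fin m) (M : Matrix (Fin (d p)) (Fin (d p)) ℂ)
    (ψ : Ket d) : Ket d :=
  WithLp.toLp 2 fun x => ∑ y : Fin (d p), M (x p) y * ψ (Function.update x p y)

/-- LOCC protocols whose final result is a guess in `Fin n`. At each step either the protocol
stops with a guess, or some party performs a measurement with measurement operators `M o`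
(`∑ o, (M o)ᴴ * M o = 1`) on its subsystem and announces the outcome `o`; the continuation may
depend on all the outcomes announced so far. -/
inductive Protocol {m : ℕ} (d : Fin m → ℕ) (n : ℕ) : Type
  | guess (k : Fin n) : Protocol d n
  | measure (p : Fin m) (l : ℕ) (M : Fin l → Matrix (Fin (d p)) (Fin (d p)) ℂ)
      (complete : ∑ o, (M o)ᴴ * M o = 1) (next : Fin l → Protocol d n) : Protocol d n

/-- The probability that the protocol ends with the guess `k` on the normalised input `ψ`. The
post-measurement states are not renormalised in the recursion, so that the squared norm of the
final vector is the probability of the whole sequence of outcomes. -/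
def Protocol.prob {m : ℕ} {d : Fin m → ℕ} {n : ℕ} : Protocol d n → Ket d → Fin n → ℝ
  | .guess k', ψ, k => if k' = k then ‖ψ‖ ^ 2 else 0
  | .measure p _ M _ next, ψ, k => ∑ o, (next o).prob (applyLocal p (M o) ψ) k

/-- The product states with local vectors `φ` can be perfectly distinguished by LOCC: some
protocol identifies each of them with probability one. -/
def LOCCDistinguishable {m n : ℕ} {d : Fin m → ℕ} (φ : LocalVectors d n) : Prop :=
  ∃ P : Protocol d n, ∀ j, P.prob (productKet (φ j)) j = 1

/-- The first exceptional graph. In the labels `1, …, 5` (here `0, …, 4`): colour 1 consists of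
`42, 43, 45, 12, 35`, colour 2 of `14, 13, 25`, colour 3 of `15, 23`. State 4 is joined to
`2, 3, 5` in colour 1 and to `1` in colour 2, and on `{1, 2, 3, 5}` each colour is a perfect
matching. -/
def starMatchingGraph : ColoredGraph 3 5 :=
  ![SimpleGraph.fromEdgeSet {s(3, 1), s(3, 2), s(3, 4), s(0, 1), s(2, 4)},
    SimpleGraph.fromEdgeSet {s(0, 3), s(0, 2), s(1, 4)},
    SimpleGraph.fromEdgeSet {s(0, 4), s(1, 2)}]

/-- The second exceptional graph. In the labels `1, …, 5` (here `0, …, 4`): colour 1 is the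
5-cycle `14, 43, 32, 25, 51`, colour 2 consists of `12, 13, 45`, colour 3 of `24, 35`. -/
def pentagonGraph : ColoredGraph 3 5 :=
  ![SimpleGraph.fromEdgeSet {s(0, 3), s(3, 2), s(2, 1), s(1, 4), s(4, 0)},
    SimpleGraph.fromEdgeSet {s(0, 1), s(0, 2), s(3, 4)},
    SimpleGraph.fromEdgeSet {s(1, 3), s(2, 4)}]

/-- The three local vectors of a tripartite product state. -/
def triple {a b c : ℕ} (u : EuclideanSpace ℂ (Fin a)) (v : EuclideanSpace ℂ (Fin b))
    (w : EuclideanSpace ℂ (Fin c)) : (i : Fin 3) → EuclideanSpace ℂ (Fin (![a, b, c] i))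
  | 0 => u
  | 1 => v
  | 2 => w

/-- The complex number `1 / √k`. -/
def invSqrt (k : ℕ) : ℂ := ((1 / √(k : ℝ) : ℝ) : ℂ)

/-- Five product states of `ℂ³ ⊗ ℂ² ⊗ ℂ²`:
`|0⟩|0⟩(√(1/3)|0⟩ + √(2/3)|1⟩)`, `(1/√6)|0+1-2⟩|1⟩|0+1⟩`, `(1/√2)|0+2⟩|1⟩|0⟩`,
`(1/2)|1⟩|0+1⟩|0-1⟩`, `(1/2)|1+2⟩|0-1⟩|1⟩`. -/
def exampleOne : LocalVectors ![3, 2, 2] 5 :=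
  ![triple !₂[1, 0, 0] !₂[1, 0] (invSqrt 3 • !₂[1, ((√2 : ℝ) : ℂ)]),
    triple (invSqrt 3 • !₂[1, 1, -1]) !₂[0, 1] (invSqrt 2 • !₂[1, 1]),
    triple (invSqrt 2 • !₂[1, 0, 1]) !₂[0, 1] !₂[1, 0],
    triple !₂[0, 1, 0] (invSqrt 2 • !₂[1, 1]) (invSqrt 2 • !₂[1, -1]),
    triple (invSqrt 2 • !₂[0, 1, 1]) (invSqrt 2 • !₂[1, -1]) !₂[0, 1]]

/-- Five product states of `ℂ³ ⊗ ℂ² ⊗ ℂ³`: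
`|0⟩|0⟩|0⟩`, `(1/√6)|0+1-2⟩|1⟩|0+1⟩`, `(1/2)|0+2⟩|1⟩|0+2⟩`,
`(1/2)|1⟩|0+1⟩|0-1⟩`, `(1/(2√2))|1+2⟩|0-1⟩|0-2⟩`. -/
def exampleTwo : LocalVectors ![3, 2, 3] 5 :=
  ![triple !₂[1, 0, 0] !₂[1, 0] !₂[1, 0, 0],
    triple (invSqrt 3 • !₂[1, 1, -1]) !₂[0, 1] (invSqrt 2 • !₂[1, 1, 0]),
    triple (invSqrt 2 • !₂[1, 0, 1]) !₂[0, 1] (invSqrt 2 • !₂[1, 0, 1]),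
    triple !₂[0, 1, 0] (invSqrt 2 • !₂[1, 1]) (invSqrt 2 • !₂[1, -1, 0]),
    triple (invSqrt 2 • !₂[0, 1, 1]) (invSqrt 2 • !₂[1, -1]) (invSqrt 2 • !₂[1, 0, -1])]

end LocalDiscrimination

end

noncomputable section

namespace LocalDiscrimination

/-- A matrix acting on a vector of Euclidean space. -/
abbrev act {d : ℕ} (M : Matrix (Fin d) (Fin d) ℂ) (v : EuclideanSpace ℂ (Fin d)) :
    EuclideanSpace ℂ (Fin d) :=
  WithLp.toLp 2 (M *ᵥ v.ofLp)

lemma act_one {d : ℕ} (v : EuclideanSpace ℂ (Fin d)) : act 1 v = v := by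
  simp [act]

lemma act_mul {d : ℕ} (M N : Matrix (Fin d) (Fin d) ℂ) (v : EuclideanSpace ℂ (Fin d)) :
    act (M * N) v = act M (act N v) := by
  simp [act, Matrix.mulVec_mulVec]

lemma inner_act_act {d : ℕ} (M : Matrix (Fin d) (Fin d) ℂ) (u v : EuclideanSpace ℂ (Fin d)) :
    inner ℂ (act M u) (act M v) = star u.ofLp ⬝ᵥ ((Mᴴ * M) *ᵥ v.ofLp) := by
  rw [EuclideanSpace.inner_eq_star_dotProduct, dotProduct_comm, ← Matrix.mulVec_mulVec,
    Matrix.star_mulVec, ← Matrix.dotProduct_mulVec]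

lemma sum_inner_act {d l : ℕ} {M : Fin l → Matrix (Fin d) (Fin d) ℂ}
    (h : ∑ o, (M o)ᴴ * M o = 1) (u v : EuclideanSpace ℂ (Fin d)) :
    ∑ o, inner ℂ (act (M o) u) (act (M o) v) = inner ℂ u v := by
  simp_rw [inner_act_act]
  rw [← dotProduct_sum, ← Matrix.sum_mulVec, h, Matrix.one_mulVec,
    EuclideanSpace.inner_eq_star_dotProduct, dotProduct_comm]

section

variable {m n : ℕ} {d : Fin m → ℕ}

/-- The local vectors after party `p` applies `M`. -/
def applyAt (p : Fin m) (M : Matrix (Fin (d p)) (Fin (d p)) ℂ)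
    (φ : (i : Fin m) → EuclideanSpace ℂ (Fin (d i))) :
    (i : Fin m) → EuclideanSpace ℂ (Fin (d i)) :=
  Function.update φ p (act M (φ p))

lemma applyAt_self (p : Fin m) (M : Matrix (Fin (d p)) (Fin (d p)) ℂ)
    (φ : (i : Fin m) → EuclideanSpace ℂ (Fin (d i))) : applyAt p M φ p = act M (φ p) :=
  Function.update_self ..

lemma applyAt_of_ne {p i : Fin m} (h : i ≠ p) (M : Matrix (Fin (d p)) (Fin (d p)) ℂ)
    (φ : (i : Fin m) → EuclideanSpace ℂ (Fin (d i))) : applyAt p M φ i = φ i :=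
  Function.update_of_ne h ..

lemma applyLocal_productKet (p : Fin m) (M : Matrix (Fin (d p)) (Fin (d p)) ℂ)
    (φ : (i : Fin m) → EuclideanSpace ℂ (Fin (d i))) :
    applyLocal p M (productKet φ) = productKet (applyAt p M φ) := by
  ext x
  simp only [applyLocal, productKet, applyAt]
  rw [← Finset.mul_prod_erase _ _ (Finset.mem_univ p)]
  simp only [Function.update_self, act, Matrix.mulVec, dotProduct, Finset.sum_mul]
  refine Finset.sum_congr rfl fun y _ => ?_
  rw [← Finset.mul_prod_erase _ _ (Finset.mem_univ p), Function.update_self, mul_assoc]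
  congr 2
  refine Finset.prod_congr rfl fun i hi => ?_
  have hi : i ≠ p := Finset.ne_of_mem_erase hi
  simp [Function.update_of_ne hi]

lemma inner_productKet (φ ψ : (i : Fin m) → EuclideanSpace ℂ (Fin (d i))) :
    inner ℂ (productKet φ) (productKet ψ) = ∏ i, inner ℂ (φ i) (ψ i) := by
  simp only [PiLp.inner_apply, productKet, RCLike.inner_apply, map_prod]
  rw [Finset.prod_univ_sum, Fintype.piFinset_univ]
  exact Finset.sum_congr rfl fun x _ => Finset.prod_mul_distrib.symm

lemma productKet_eq_zero_iff (φ : (i : Fin m) → EuclideanSpace ℂ (Fin (d i))) :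
    productKet φ = 0 ↔ ∃ i, φ i = 0 := by
  rw [← inner_self_eq_zero (𝕜 := ℂ), inner_productKet, Finset.prod_eq_zero_iff]
  simp

lemma sum_inner_applyAt {p : Fin m} {l : ℕ} {M : Fin l → Matrix (Fin (d p)) (Fin (d p)) ℂ}
    (h : ∑ o, (M o)ᴴ * M o = 1) (φ ψ : (i : Fin m) → EuclideanSpace ℂ (Fin (d i))) :
    ∑ o, inner ℂ (productKet (applyAt p (M o) φ)) (productKet (applyAt p (M o) ψ)) =
      inner ℂ (productKet φ) (productKet ψ) := by
  simp only [inner_productKet]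
  have key (o : Fin l) : ∏ i, inner ℂ (applyAt p (M o) φ i) (applyAt p (M o) ψ i) =
      inner ℂ (act (M o) (φ p)) (act (M o) (ψ p)) *
        ∏ i ∈ Finset.univ.erase p, inner ℂ (φ i) (ψ i) := by
    rw [← Finset.mul_prod_erase _ _ (Finset.mem_univ p)]
    simp only [applyAt, Function.update_self]
    congr 1
    refine Finset.prod_congr rfl fun i hi => ?_
    have hi : i ≠ p := Finset.ne_of_mem_erase hi
    simp [Function.update_of_ne hi]
  simp_rw [key]
  rw [← Finset.sum_mul, sum_inner_act h,
    Finset.mul_prod_erase _ (fun i => inner ℂ (φ i) (ψ i)) (Finset.mem_univ p)]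

lemma sum_norm_sq_applyAt {p : Fin m} {l : ℕ} {M : Fin l → Matrix (Fin (d p)) (Fin (d p)) ℂ}
    (h : ∑ o, (M o)ᴴ * M o = 1) (φ : (i : Fin m) → EuclideanSpace ℂ (Fin (d i))) :
    ∑ o, ‖productKet (applyAt p (M o) φ)‖ ^ 2 = ‖productKet φ‖ ^ 2 := by
  have := sum_inner_applyAt h φ φ
  simp only [inner_self_eq_norm_sq_to_K] at this
  exact_mod_cast this

namespace Protocol

lemma prob_nonneg (P : Protocol d n) (ψ : Ket d) (k : Fin n) : 0 ≤ P.prob ψ k := by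
  induction P generalizing ψ with
  | guess k' => rw [prob]; split_ifs <;> positivity
  | measure p l M hM next ih => rw [prob]; exact Finset.sum_nonneg fun o _ => ih o _

lemma sum_prob (P : Protocol d n) (φ : (i : Fin m) → EuclideanSpace ℂ (Fin (d i))) :
    ∑ k, P.prob (productKet φ) k = ‖productKet φ‖ ^ 2 := by
  induction P generalizing φ with
  | guess k' => simp [prob]
  | measure p l M hM next ih =>
    simp only [prob]
    rw [Finset.sum_comm]
    simp_rw [applyLocal_productKet, ih]
    exact sum_norm_sq_applyAt hM φ

/-- The protocol never makes a wrong guess on the (unnormalised) product states `φ`. -/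
def Discriminates (P : Protocol d n) (φ : LocalVectors d n) : Prop :=
  ∀ j k, j ≠ k → P.prob (productKet (φ j)) k = 0

lemma Discriminates.next {p : Fin m} {l : ℕ} {M : Fin l → Matrix (Fin (d p)) (Fin (d p)) ℂ}
    {hM : ∑ o, (M o)ᴴ * M o = 1} {next : Fin l → Protocol d n} {φ : LocalVectors d n}
    (h : (measure p l M hM next).Discriminates φ) (o : Fin l) :
    (next o).Discriminates fun j => applyAt p (M o) (φ j) := by
  intro j k hjk
  have := h j k hjk
  rw [prob, Finset.sum_eq_zero_iff_of_nonneg fun o _ => prob_nonneg _ _ _] at this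
  simpa [applyLocal_productKet] using this o (Finset.mem_univ o)

lemma Discriminates.inner_eq_zero {P : Protocol d n} {φ : LocalVectors d n}
    (h : P.Discriminates φ) {j k : Fin n} (hjk : j ≠ k) :
    inner ℂ (productKet (φ j)) (productKet (φ k)) = 0 := by
  induction P generalizing φ with
  | guess g =>
    have hz : ∀ j, j ≠ g → productKet (φ j) = 0 := fun j hj => by
      have := h j g hj
      rw [prob, if_pos rfl] at this
      exact norm_eq_zero.1 (pow_eq_zero_iff two_ne_zero |>.1 this)
    by_cases hj : j = g
    · rw [hz k fun hk => hjk (hj.trans hk.symm), inner_zero_right]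
    · rw [hz j hj, inner_zero_left]
  | measure p l M hM next ih =>
    rw [← sum_inner_applyAt hM]
    refine Finset.sum_eq_zero fun o _ => ?_
    have := ih o (h.next o)
    exact this

end Protocol

lemma norm_productKet {φ : (i : Fin m) → EuclideanSpace ℂ (Fin (d i))} (h : ∀ i, ‖φ i‖ = 1) :
    ‖productKet φ‖ ^ 2 = 1 := by
  have := inner_productKet φ φ
  simp only [inner_self_eq_norm_sq_to_K, h, RCLike.ofReal_one, one_pow,
    Finset.prod_const_one] at this
  refine (RCLike.ofReal_inj (K := ℂ)).1 ?_
  rw [RCLike.ofReal_pow, this, RCLike.ofReal_one]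

lemma LOCCDistinguishable.exists_discriminates {φ : LocalVectors d n}
    (h : LOCCDistinguishable φ) (hφ : ∀ j i, ‖φ j i‖ = 1) :
    ∃ P : Protocol d n, P.Discriminates φ := by
  obtain ⟨P, hP⟩ := h
  refine ⟨P, fun j k hjk => ?_⟩
  have hs := P.sum_prob (φ j)
  rw [norm_productKet (hφ j), ← Finset.add_sum_erase _ _ (Finset.mem_univ j), hP j,
    add_eq_left, Finset.sum_eq_zero_iff_of_nonneg fun o _ => P.prob_nonneg _ _] at hs
  exact hs k (Finset.mem_erase.2 ⟨hjk.symm, Finset.mem_univ k⟩)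

/-- A criterion for indistinguishability. The class `K i` of operators of party `i` contains the
identity, and a further measurement operator of party `p` which keeps the states orthogonal and
does not kill the test vector `t p` stays in the class; no product of operators in the classes
leaves fewer than two states. -/
theorem not_LOCCDistinguishable {φ : LocalVectors d n} (hφ : ∀ j i, ‖φ j i‖ = 1)
    (K : (i : Fin m) → Matrix (Fin (d i)) (Fin (d i)) ℂ → Prop)
    (t : (i : Fin m) → EuclideanSpace ℂ (Fin (d i))) (R : Fin m → Fin n → Fin n → Prop)
    (hR : ∀ p j k, R p j k → j ≠ k) (hone : ∀ i, K i 1)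
    (ht : ∀ i A, K i A → act A (t i) ≠ 0)
    (hne : ∀ i A, K i A → ∀ p j k, p ≠ i → R p j k → inner ℂ (act A (φ j i)) (act A (φ k i)) ≠ 0)
    (hstep : ∀ p B, (∀ j k, R p j k → inner ℂ (act B (φ j p)) (act B (φ k p)) = 0) →
      act B (t p) ≠ 0 → K p B)
    {a b : Fin n} (hab : a ≠ b)
    (hleft : ∀ i A, K i A → act A (φ a i) ≠ 0 ∧ act A (φ b i) ≠ 0) :
    ¬ LOCCDistinguishable φ := by
  intro h
  obtain ⟨P, hP⟩ := h.exists_discriminates hφ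
  suffices H : ∀ (P : Protocol d n) (A : (i : Fin m) → Matrix (Fin (d i)) (Fin (d i)) ℂ),
      (∀ i, K i (A i)) → ¬ P.Discriminates fun j i => act (A i) (φ j i) by
    refine H P (fun _ => 1) hone ?_
    simpa only [act_one] using hP
  clear! P
  intro P
  induction P with
  | guess g =>
    intro A hA hP
    have hz : ∀ j, j ≠ g → ∃ i, act (A i) (φ j i) = 0 := fun j hj => by
      rw [← productKet_eq_zero_iff]
      have := hP j g hj
      rw [Protocol.prob, if_pos rfl] at this
      exact norm_eq_zero.1 (pow_eq_zero_iff two_ne_zero |>.1 this)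
    by_cases ha : a = g
    · obtain ⟨i, hi⟩ := hz b fun hb => hab (ha.trans hb.symm)
      exact (hleft i _ (hA i)).2 hi
    · obtain ⟨i, hi⟩ := hz a ha
      exact (hleft i _ (hA i)).1 hi
  | measure p l M hM next ih =>
    intro A hA hP
    obtain ⟨o, ho⟩ : ∃ o, act (M o * A p) (t p) ≠ 0 := by
      by_contra! hall
      have := sum_inner_act hM (act (A p) (t p)) (act (A p) (t p))
      simp only [act_mul] at hall
      simp only [hall, inner_zero_left, Finset.sum_const_zero] at this
      exact ht p _ (hA p) (inner_self_eq_zero.1 this.symm)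
    have hA' : ∀ j, applyAt p (M o) (fun i => act (A i) (φ j i)) =
        fun i => act (Function.update A p (M o * A p) i) (φ j i) := fun j => by
      funext i
      by_cases hi : i = p
      · subst hi
        simp [applyAt, Matrix.mulVec_mulVec]
      · simp [applyAt, Function.update_of_ne hi]
    have hnext := hP.next o
    simp only [hA'] at hnext
    refine ih o _ (fun i => ?_) hnext
    by_cases hi : i = p
    · subst hi
      rw [Function.update_self]
      refine hstep i _ (fun j k hjk => ?_) ho
      have := hnext.inner_eq_zero (hR _ _ _ hjk)
      rw [inner_productKet, Finset.prod_eq_zero_iff] at this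
      obtain ⟨q, -, hq⟩ := this
      by_cases hqi : q = i
      · subst hqi
        simpa using hq
      · rw [Function.update_of_ne hqi] at hq
        exact absurd hq (hne q _ (hA q) i j k (Ne.symm hqi) hjk)
    · rw [Function.update_of_ne hi]
      exact hA i

end

lemma exists_projective_pair {d : ℕ} (W : Submodule ℂ (EuclideanSpace ℂ (Fin d))) :
    ∃ P Q : Matrix (Fin d) (Fin d) ℂ, Pᴴ * P + Qᴴ * Q = 1 ∧
      (∀ v, act P v = W.starProjection v) ∧ ∀ v, act Q v = v - W.starProjection v := by
  set e := Matrix.toEuclideanCLM (n := Fin d) (𝕜 := ℂ)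
  have hP (v) : act (e.symm W.starProjection) v = W.starProjection v := by
    have : act (e.symm W.starProjection) v = e (e.symm W.starProjection) v := rfl
    rw [this, e.apply_symm_apply]
  have hQ (v) : act (1 - e.symm W.starProjection) v = v - W.starProjection v := by
    rw [← hP]
    simp [act, Matrix.sub_mulVec]
  refine ⟨e.symm W.starProjection, 1 - e.symm W.starProjection, ?_, hP, hQ⟩
  have hproj := isStarProjection_starProjection (U := W)
  have h1 : (e.symm W.starProjection)ᴴ = e.symm W.starProjection := by
    refine EquivLike.injective e ?_
    rw [← Matrix.star_eq_conjTranspose, map_star e, e.apply_symm_apply,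
      hproj.isSelfAdjoint.star_eq]
  have h2 : e.symm W.starProjection * e.symm W.starProjection = e.symm W.starProjection := by
    refine EquivLike.injective e ?_
    rw [map_mul e, e.apply_symm_apply, hproj.isIdempotentElem.eq]
  rw [Matrix.conjTranspose_sub, Matrix.conjTranspose_one, h1]
  noncomm_ring
  rw [h2]
  abel

lemma inner_starProjection_eq_zero {F : Type*} [NormedAddCommGroup F] [InnerProductSpace ℂ F]
    (W : Submodule ℂ F) [W.HasOrthogonalProjection] {u v : F} (h : inner ℂ u v = 0)
    (hW : u ∈ W ∨ v ∈ W ∨ u ∈ Wᗮ ∨ v ∈ Wᗮ) :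
    inner ℂ (W.starProjection u) v = 0 := by
  rcases hW with hu | hv | hu | hv
  · rwa [Submodule.starProjection_eq_self_iff.2 hu]
  · rwa [Submodule.inner_starProjection_left_eq_right, Submodule.starProjection_eq_self_iff.2 hv]
  · rw [(Submodule.starProjection_apply_eq_zero_iff W).2 hu, inner_zero_left]
  · rw [Submodule.inner_starProjection_left_eq_right,
      (Submodule.starProjection_apply_eq_zero_iff W).2 hv, inner_zero_right]

lemma inner_starProjection_starProjection {F : Type*} [NormedAddCommGroup F]
    [InnerProductSpace ℂ F] (W : Submodule ℂ F) [W.HasOrthogonalProjection] (u v : F) :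
    inner ℂ (W.starProjection u) (W.starProjection v) = inner ℂ (W.starProjection u) v := by
  rw [← Submodule.inner_starProjection_left_eq_right,
    Submodule.starProjection_eq_self_iff.2 (Submodule.starProjection_apply_mem _ _)]

/-- A tree of projective measurements: at `split p S a b` party `p` measures whether its system is
in the span of the local vectors of the states in `S`, and goes on with `a` if so, with `b` if
not. -/
inductive Strategy (m n : ℕ) : Type
  | answer (k : Fin n) : Strategy m n
  | split (p : Fin m) (S : List (Fin n)) (a b : Strategy m n) : Strategy m n

namespace Strategy

variable {m n : ℕ}

/-- State `v` is known to be orthogonal to the states in `S` on subsystem `p`. -/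
def perp (E : Fin m → Fin n → Fin n → Bool) (p : Fin m) (S : List (Fin n)) (v : Fin n) : Bool :=
  S.all fun s => E p v s

/-- The orthogonality relations which survive the projections of party `p` on the span of `S` and
on its complement. -/
def surviving (E : Fin m → Fin n → Fin n → Bool) (p : Fin m) (S : List (Fin n)) (i : Fin m)
    (a b : Fin n) : Bool :=
  E i a b && (i != p || S.contains a || S.contains b || perp E p S a || perp E p S b)

/-- The strategy identifies the states with labels in `V`, given the orthogonality relations
`E`. -/
def wins : Strategy m n → (Fin n → Bool) → (Fin m → Fin n → Fin n → Bool) → Bool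
  | answer k, V, _ => (List.finRange n).all fun j => !V j || j == k
  | split p S a b, V, E =>
    a.wins (fun v => V v && !perp E p S v) (surviving E p S) &&
      b.wins (fun v => V v && !S.contains v) (surviving E p S)

variable {d : Fin m → ℕ}

lemma productKet_applyAt_eq_zero {φ : (i : Fin m) → EuclideanSpace ℂ (Fin (d i))}
    (h : productKet φ = 0) (p : Fin m) (M : Matrix (Fin (d p)) (Fin (d p)) ℂ) :
    productKet (applyAt p M φ) = 0 := by
  rw [← applyLocal_productKet, h]
  ext x
  simp [applyLocal]

theorem exists_protocol {n' : ℕ} (σ : Fin n → Fin n') (T : Strategy m n) {V : Fin n → Bool}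
    {E : Fin m → Fin n → Fin n → Bool} (hT : T.wins V E) {φ : LocalVectors d n}
    (hE : ∀ i a b, E i a b → inner ℂ (φ a i) (φ b i) = 0)
    (hV : ∀ j, V j = false → productKet (φ j) = 0) :
    ∃ P : Protocol d n', ∀ j, P.prob (productKet (φ j)) (σ j) = ‖productKet (φ j)‖ ^ 2 := by
  induction T generalizing V E φ with
  | answer k =>
    refine ⟨.guess (σ k), fun j => ?_⟩
    simp only [wins, List.all_eq_true, List.mem_finRange, true_imp_iff, Bool.or_eq_true,
      Bool.not_eq_true', beq_iff_eq] at hT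
    rw [Protocol.prob]
    rcases hT j with h | h
    · simp [hV j h]
    · simp [h]
  | split p S a b iha ihb =>
    simp only [wins, Bool.and_eq_true] at hT
    set W := Submodule.span ℂ {u | ∃ s ∈ S, u = φ s p} with hW
    obtain ⟨P, Q, hPQ, hP, hQ⟩ := exists_projective_pair W
    have hmem (s) (hs : S.contains s = true) : φ s p ∈ W :=
      Submodule.subset_span ⟨s, List.contains_iff_mem.1 hs, rfl⟩
    have hperp (v) (hv : perp E p S v = true) : φ v p ∈ Wᗮ := by
      have hle : W ≤ (Submodule.span ℂ {φ v p})ᗮ := by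
        refine Submodule.span_le.2 ?_
        rintro u ⟨s, hs, rfl⟩
        exact Submodule.mem_orthogonal_singleton_iff_inner_right.2
          (hE p v s (List.all_eq_true.1 hv s hs))
      exact Submodule.le_orthogonal_iff_le_orthogonal.1 hle
        (Submodule.mem_span_singleton_self _)
    have hsurv (M : Matrix (Fin (d p)) (Fin (d p)) ℂ)
        (hM : ∀ u v, inner ℂ u v = 0 → (u ∈ W ∨ v ∈ W ∨ u ∈ Wᗮ ∨ v ∈ Wᗮ) →
          inner ℂ (act M u) (act M v) = 0) :
        ∀ i x y, surviving E p S i x y →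
          inner ℂ (applyAt p M (φ x) i) (applyAt p M (φ y) i) = 0 := by
      intro i x y hxy
      simp only [surviving, Bool.and_eq_true, Bool.or_eq_true, bne_iff_ne] at hxy
      obtain ⟨h0, h⟩ := hxy
      by_cases hi : i = p
      · subst hi
        simp only [applyAt, Function.update_self]
        refine hM _ _ (hE _ _ _ h0) ?_
        rcases h with (((h | h) | h) | h) | h
        · exact absurd rfl h
        · exact .inl (hmem _ h)
        · exact .inr (.inl (hmem _ h))
        · exact .inr (.inr (.inl (hperp _ h)))
        · exact .inr (.inr (.inr (hperp _ h)))
      · simp only [applyAt, Function.update_of_ne hi]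
        exact hE _ _ _ h0
    have hkill (M : Matrix (Fin (d p)) (Fin (d p)) ℂ) (j) (h : act M (φ j p) = 0) :
        productKet (applyAt p M (φ j)) = 0 :=
      (productKet_eq_zero_iff _).2 ⟨p, by rw [applyAt, Function.update_self, h]⟩
    obtain ⟨Pa, hPa⟩ := iha hT.1 (φ := fun j => applyAt p P (φ j))
      (hsurv P fun u v huv h => by
        rw [hP, hP, inner_starProjection_starProjection, inner_starProjection_eq_zero W huv h])
      (fun j hj => by
        simp only [Bool.and_eq_false_iff, Bool.not_eq_false'] at hj
        rcases hj with hj | hj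
        · exact productKet_applyAt_eq_zero (hV j hj) _ _
        · exact hkill _ _ (by
            rw [hP, (Submodule.starProjection_apply_eq_zero_iff W).2 (hperp _ hj)]))
    obtain ⟨Pb, hPb⟩ := ihb hT.2 (φ := fun j => applyAt p Q (φ j))
      (hsurv Q fun u v huv h => by
        rw [hQ, hQ, inner_sub_right, inner_sub_left, inner_sub_left,
          inner_starProjection_starProjection, ← Submodule.inner_starProjection_left_eq_right,
          inner_starProjection_eq_zero W huv h, huv]
        simp)
      (fun j hj => by
        simp only [Bool.and_eq_false_iff, Bool.not_eq_false'] at hj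
        rcases hj with hj | hj
        · exact productKet_applyAt_eq_zero (hV j hj) _ _
        · exact hkill _ _ (by
            rw [hQ, Submodule.starProjection_eq_self_iff.2 (hmem _ hj), sub_self]))
    have hcomp : ∑ o, (![P, Q] o)ᴴ * ![P, Q] o = 1 := by simpa [Fin.sum_univ_two] using hPQ
    refine ⟨.measure p 2 ![P, Q] hcomp ![Pa, Pb], fun j => ?_⟩
    rw [← sum_norm_sq_applyAt hcomp (φ j), Protocol.prob]
    simp only [applyLocal_productKet, Fin.sum_univ_two]
    exact congrArg₂ _ (hPa j) (hPb j)

end Strategy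

/-- States whose orthogonality relations, after a relabelling, contain those of a winning strategy
can be perfectly distinguished. -/
theorem LOCCDistinguishable.of_wins {m n : ℕ} {d : Fin m → ℕ} {φ : LocalVectors d n}
    (hφ : ∀ j i, ‖φ j i‖ = 1) (T : Strategy m n) {E : Fin m → Fin n → Fin n → Bool}
    (hT : T.wins (fun _ => true) E) (σ : Equiv.Perm (Fin n))
    (hE : ∀ i a b, E i (σ a) (σ b) → inner ℂ (φ a i) (φ b i) = 0) :
    LOCCDistinguishable φ := by
  obtain ⟨P, hP⟩ := T.exists_protocol (d := d) σ.symm hT (φ := fun j => φ (σ.symm j))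
    (fun i a b h => hE i _ _ (by simpa using h)) (by simp)
  refine ⟨P, fun j => ?_⟩
  have := hP (σ j)
  simp only [Equiv.symm_apply_apply] at this
  rw [this, norm_productKet (hφ j)]

/-- A measurement reduces the discrimination of product states to that of the states after each
of the outcomes. -/
theorem LOCCDistinguishable.of_measurement {m n : ℕ} {d : Fin m → ℕ} {φ : LocalVectors d n}
    (hφ : ∀ j i, ‖φ j i‖ = 1) {p : Fin m} {l : ℕ} {M : Fin l → Matrix (Fin (d p)) (Fin (d p)) ℂ}
    (hM : ∑ o, (M o)ᴴ * M o = 1)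
    (h : ∀ o, ∃ P : Protocol d n, ∀ j, P.prob (productKet (applyAt p (M o) (φ j))) j =
      ‖productKet (applyAt p (M o) (φ j))‖ ^ 2) :
    LOCCDistinguishable φ := by
  choose P hP using h
  refine ⟨.measure p l M hM P, fun j => ?_⟩
  rw [Protocol.prob, ← norm_productKet (hφ j), ← sum_norm_sq_applyAt hM (φ j)]
  simp only [applyLocal_productKet, hP]

/-- The vertices are labelled by the marks of a Golomb ruler, so that a pair of vertices is
determined by the sum of its labels. -/
def vertexLabel : Fin 5 → ℕ := ![0, 1, 4, 9, 11]

/-- A colouring of the pairs of vertices is encoded by the number whose decimal digit at position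
`j + k` is the colour of the pair with labels `j`, `k`. -/
def colorOf (x j k : ℕ) : ℕ := Nat.mod (Nat.div x (Nat.pow 10 (Nat.add j k))) 10

lemma colorOf_eq (x j k : ℕ) : colorOf x j k = x / 10 ^ (j + k) % 10 := rfl

lemma colorOf_comm (x j k : ℕ) : colorOf x j k = colorOf x k j := by
  rw [colorOf_eq, colorOf_eq, add_comm]

/-- The coloured graph with a given code. -/
def codeGraph (x : ℕ) : ColoredGraph 3 5 := fun i =>
  { Adj := fun j k => j ≠ k ∧ colorOf x (vertexLabel j) (vertexLabel k) = i
    symm := ⟨fun _ _ h => ⟨h.1.symm, by rw [colorOf_comm]; exact h.2⟩⟩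
    loopless := ⟨fun _ h => h.1 rfl⟩ }

/-- The codes of the 30 orthogonality graphs with orthogonality vector `(5, 3, 2)`, with winning
strategies for all but two of them. -/
def graphTable : List (ℕ × Option (Strategy 3 5)) :=
  [(200002011010000000000, some (.split 0 [0] (.answer 0) (.split 0 [1] (.split 1 [1] (.answer 1)
      (.split 2 [3] (.answer 3) (.answer 4))) (.split 1 [2] (.split 2 [2] (.answer 2) (.answer 4))
      (.split 2 [3] (.answer 3) (.answer 4)))))),
    (100002021010000000000, some (.split 0 [0] (.answer 0) (.split 0 [1] (.split 1 [1] (.answer 1)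
      (.split 1 [3] (.answer 3) (.answer 4))) (.split 1 [3] (.split 2 [2] (.answer 2) (.answer 3))
      (.split 2 [2] (.answer 2) (.answer 4)))))),
    (100002012010000000000, some (.split 0 [0] (.answer 0) (.split 0 [1] (.split 1 [1] (.split 2
      [1] (.answer 1) (.answer 4)) (.split 1 [3] (.answer 3) (.answer 4))) (.split 1 [2] (.split 2
      [2] (.answer 2) (.answer 4)) (.split 1 [3] (.answer 3) (.answer 4)))))),
    (100001022010000000000, some (.split 0 [0] (.answer 0) (.split 0 [1] (.split 1 [1] (.split 2
      [1] (.answer 1) (.answer 4)) (.split 1 [3] (.answer 3) (.answer 4))) (.split 1 [2] (.split 2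
      [2] (.answer 2) (.answer 3)) (.split 1 [3] (.answer 3) (.answer 4)))))),
    (200002011100000000000, some (.split 0 [0] (.split 1 [0] (.answer 0) (.answer 4)) (.split 0
      [1] (.split 1 [1] (.answer 1) (.answer 4)) (.split 1 [2] (.split 2 [2] (.answer 2) (.answer
      4)) (.split 2 [3] (.answer 3) (.answer 4)))))),
    (200001021100000000000, some (.split 0 [0] (.split 1 [0] (.answer 0) (.answer 4)) (.split 0
      [1] (.split 1 [1] (.answer 1) (.answer 4)) (.split 1 [2] (.split 2 [2] (.answer 2) (.answer
      3)) (.split 2 [3] (.answer 3) (.answer 4)))))),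
    (200001012100000000000, some (.split 0 [0] (.split 1 [0] (.answer 0) (.answer 4)) (.split 0
      [1] (.split 2 [1] (.answer 1) (.answer 4)) (.split 1 [2] (.answer 2) (.split 2 [3] (.answer
      3) (.answer 4)))))),
    (100001022100000000000, some (.split 0 [0] (.split 1 [0] (.answer 0) (.answer 4)) (.split 0
      [1] (.split 2 [1] (.answer 1) (.answer 4)) (.split 1 [2] (.split 2 [2] (.answer 2) (.answer
      3)) (.split 1 [3] (.answer 3) (.answer 4)))))),
    (100001012200000000000, some (.split 0 [0] (.split 2 [0] (.answer 0) (.answer 4)) (.split 0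
      [1] (.split 2 [1] (.answer 1) (.answer 4)) (.split 1 [2] (.answer 2) (.split 1 [3] (.answer
      3) (.answer 4)))))),
    (200002010110000000000, some (.split 0 [0] (.split 1 [0] (.answer 0) (.answer 4)) (.split 0
      [1] (.split 1 [1] (.answer 1) (.answer 3)) (.split 1 [2] (.split 2 [2] (.answer 2) (.answer
      4)) (.split 2 [3] (.answer 3) (.answer 4)))))),
    (100002020110000000000, some (.split 0 [0] (.split 1 [0] (.answer 0) (.answer 4)) (.split 0
      [1] (.split 1 [1] (.answer 1) (.answer 3)) (.split 1 [3] (.split 2 [2] (.answer 2) (.answer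
      3)) (.split 2 [2] (.answer 2) (.answer 4)))))),
    (200001010120000000000, some (.split 0 [0] (.split 1 [0] (.answer 0) (.answer 4)) (.split 0
      [1] (.split 2 [1] (.answer 1) (.answer 3)) (.split 1 [2] (.answer 2) (.split 2 [3] (.answer
      3) (.answer 4)))))),
    (100002010120000000000, some (.split 0 [0] (.split 1 [0] (.answer 0) (.answer 4)) (.split 0
      [1] (.split 2 [1] (.answer 1) (.answer 3)) (.split 1 [2] (.split 2 [2] (.answer 2) (.answer
      4)) (.split 1 [3] (.answer 3) (.answer 4)))))),
    (100001020120000000000, some (.split 0 [0] (.split 1 [0] (.answer 0) (.answer 4)) (.split 0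
      [1] (.split 2 [1] (.answer 1) (.answer 3)) (.split 1 [2] (.split 2 [2] (.answer 2) (.answer
      3)) (.split 1 [3] (.answer 3) (.answer 4)))))),
    (100001010220000000000, some (.split 0 [0] (.split 2 [0] (.answer 0) (.answer 4)) (.split 0
      [1] (.split 2 [1] (.answer 1) (.answer 3)) (.split 1 [2] (.answer 2) (.split 1 [3] (.answer
      3) (.answer 4)))))),
    (2021110000000000, some (.split 0 [0] (.split 1 [0] (.answer 0) (.answer 4)) (.split 1 [1]
      (.split 0 [1] (.answer 1) (.answer 2)) (.split 0 [3] (.split 2 [2] (.answer 2) (.answer 3))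
      (.split 2 [2] (.answer 2) (.answer 4)))))),
    (2012110000000000, some (.split 0 [0] (.split 1 [0] (.answer 0) (.answer 4)) (.split 1 [1]
      (.split 0 [1] (.split 2 [1] (.answer 1) (.answer 4)) (.split 2 [2] (.answer 2) (.answer 4)))
      (.split 0 [3] (.split 1 [2] (.answer 2) (.answer 3)) (.split 2 [2] (.answer 2) (.answer
      4)))))),
    (1021120000000000, some (.split 0 [0] (.split 1 [0] (.answer 0) (.answer 4)) (.split 1 [1]
      (.split 0 [1] (.split 2 [1] (.answer 1) (.answer 3)) (.split 2 [2] (.answer 2) (.answer 3)))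
      (.split 0 [3] (.split 2 [2] (.answer 2) (.answer 3)) (.split 1 [2] (.answer 2) (.answer
      4)))))),
    (2011210000000000, some (.split 0 [0] (.split 2 [0] (.answer 0) (.answer 4)) (.split 1 [1]
      (.split 0 [1] (.answer 1) (.answer 2)) (.split 0 [3] (.split 1 [2] (.answer 2) (.answer 3))
      (.split 2 [2] (.answer 2) (.answer 4)))))),
    (1021210000000000, some (.split 0 [0] (.split 2 [0] (.answer 0) (.answer 4)) (.split 1 [1]
      (.split 0 [1] (.answer 1) (.answer 2)) (.split 0 [3] (.split 2 [2] (.answer 2) (.answer 3))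
      (.split 1 [2] (.answer 2) (.answer 4)))))),
    (200000020110000100000, some (.split 0 [0] (.split 1 [0] (.answer 0) (.answer 4)) (.split 0
      [1] (.split 1 [1] (.answer 1) (.split 2 [2] (.answer 2) (.answer 3))) (.split 0 [2] (.split
      2 [2] (.answer 2) (.answer 3)) (.split 2 [3] (.answer 3) (.answer 4)))))),
    (100000020120000100000, some (.split 0 [0] (.split 1 [0] (.answer 0) (.answer 4)) (.split 0
      [1] (.split 1 [1] (.split 2 [1] (.answer 1) (.answer 3)) (.split 2 [2] (.answer 2) (.answer
      3))) (.split 0 [2] (.split 2 [2] (.answer 2) (.answer 3)) (.split 1 [3] (.answer 3) (.answer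
      4)))))),
    (200000010110000200000, some (.split 0 [0] (.split 1 [0] (.answer 0) (.answer 4)) (.split 0
      [1] (.split 1 [1] (.split 2 [1] (.answer 1) (.answer 2)) (.split 1 [2] (.answer 2) (.answer
      3))) (.split 0 [2] (.split 1 [2] (.answer 2) (.answer 3)) (.split 2 [3] (.answer 3) (.answer
      4)))))),
    (100000020110000200000, some (.split 0 [0] (.split 1 [0] (.answer 0) (.answer 4)) (.split 0
      [1] (.split 1 [1] (.split 2 [1] (.answer 1) (.answer 2)) (.split 2 [2] (.answer 2) (.answer
      3))) (.split 0 [2] (.split 2 [2] (.answer 2) (.answer 3)) (.split 1 [3] (.answer 3) (.answer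
      4)))))),
    (200000010210000100000, some (.split 0 [0] (.split 2 [0] (.answer 0) (.answer 4)) (.split 0
      [1] (.split 1 [1] (.answer 1) (.split 1 [2] (.answer 2) (.answer 3))) (.split 0 [2] (.split
      1 [2] (.answer 2) (.answer 3)) (.split 2 [3] (.answer 3) (.answer 4)))))),
    (1201000210000, none),
    (100000020210000100000, some (.split 0 [0] (.split 2 [0] (.answer 0) (.answer 4)) (.split 0
      [1] (.split 1 [1] (.answer 1) (.split 2 [2] (.answer 2) (.answer 3))) (.split 0 [2] (.split
      2 [2] (.answer 2) (.answer 3)) (.split 1 [3] (.answer 3) (.answer 4)))))),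
    (100000010210000200000, some (.split 0 [0] (.split 2 [0] (.answer 0) (.answer 4)) (.split 0
      [1] (.split 1 [1] (.split 2 [1] (.answer 1) (.answer 2)) (.split 1 [2] (.answer 2) (.answer
      3))) (.split 0 [2] (.split 1 [2] (.answer 2) (.answer 3)) (.split 1 [3] (.answer 3) (.answer
      4)))))),
    (21101000200000, some (.split 1 [0] (.split 0 [0] (.answer 0) (.split 2 [1] (.answer 1)
      (.answer 2))) (.split 0 [3] (.split 2 [2] (.answer 2) (.answer 3)) (.split 0 [2] (.split 2
      [1] (.answer 1) (.answer 2)) (.split 1 [1] (.answer 1) (.answer 4)))))),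
    (100002000020000010010, none)]

/-- Sum over the labels of the vertices. -/
def labelSum (f : ℕ → ℕ) : ℕ :=
  Nat.add (f 0) (Nat.add (f 1) (Nat.add (f 4) (Nat.add (f 9) (f 11))))

lemma labelSum_eq (f : ℕ → ℕ) : labelSum f = ∑ j, f (vertexLabel j) := by
  simp [labelSum, Fin.sum_univ_five, vertexLabel, add_assoc]

/-- An isomorphism invariant: `∑ v, ((C * C) 1 v) ^ 3` for the matrix `C` of colours. -/
def graphInvariant (x : ℕ) : ℕ :=
  labelSum fun v => Nat.pow
    (labelSum fun u => Nat.mul (colorOf x v u) (labelSum fun t => colorOf x u t)) 3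

/-- A code of a colouring with the colours `0, 1, 2`, whose other digits on the diagonal vanish. -/
def IsCode (x : ℕ) : Prop :=
  ∀ j k, colorOf x (vertexLabel j) (vertexLabel k) < 3 ∧
    colorOf x (vertexLabel j) (vertexLabel j) = 0

instance (x : ℕ) : Decidable (IsCode x) := inferInstanceAs (Decidable (∀ _, _))

lemma colorOf_eq_of_forall_adj {x y : ℕ} (hx : IsCode x) (hy : IsCode y)
    {σ : Equiv.Perm (Fin 5)}
    (h : ∀ i j k, (codeGraph x i).Adj j k ↔ (codeGraph y i).Adj (σ j) (σ k)) (j k : Fin 5) :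
    colorOf x (vertexLabel j) (vertexLabel k) =
      colorOf y (vertexLabel (σ j)) (vertexLabel (σ k)) := by
  by_cases hjk : j = k
  · subst hjk
    rw [(hx j j).2, (hy _ (σ j)).2]
  · exact ((h ⟨_, (hx j k).1⟩ j k).1 ⟨hjk, rfl⟩).2.symm

lemma graphInvariant_eq {x y : ℕ} (hx : IsCode x) (hy : IsCode y)
    (h : (codeGraph x).Isomorphic (codeGraph y)) : graphInvariant x = graphInvariant y := by
  obtain ⟨σ, hσ⟩ := h
  have e (f : Fin 5 → ℕ) : ∑ j, f (σ j) = ∑ j, f j := Equiv.sum_comp σ f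
  have ht (u : Fin 5) := e fun t => colorOf y (vertexLabel (σ u)) (vertexLabel t)
  have hu (v : Fin 5) := e fun u => Nat.mul (colorOf y (vertexLabel (σ v)) (vertexLabel u))
    (∑ t, colorOf y (vertexLabel u) (vertexLabel t))
  have hv := e fun v => Nat.pow (∑ u, Nat.mul (colorOf y (vertexLabel v) (vertexLabel u))
    (∑ t, colorOf y (vertexLabel u) (vertexLabel t))) 3
  simp only [graphInvariant, labelSum_eq, colorOf_eq_of_forall_adj hx hy hσ, ht, hu, hv]

/-- The labels of the vertices. -/
def labels : List ℕ := [0, 1, 4, 9, 11]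

lemma mem_labels {a : ℕ} (h : a ∈ labels) : ∃ j, a = vertexLabel j := by
  simp only [labels, List.mem_cons, List.not_mem_nil, or_false] at h
  rcases h with rfl | rfl | rfl | rfl | rfl
  exacts [⟨0, rfl⟩, ⟨1, rfl⟩, ⟨2, rfl⟩, ⟨3, rfl⟩, ⟨4, rfl⟩]

/-- The pair `j`, `k` has the same colour in `x` as the pair of vertices `a ≠ b` in `y`. -/
def samePair (x j k y a b : ℕ) : Bool :=
  !Nat.beq a b && Nat.beq (colorOf x j k) (colorOf y a b)

/-- Backtracking search for an isomorphism. -/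
def isoSearch (x y : ℕ) : Bool :=
  labels.any fun a => labels.any fun b => samePair x 0 1 y a b &&
  labels.any fun c => samePair x 0 4 y a c && samePair x 1 4 y b c &&
  labels.any fun d => samePair x 0 9 y a d && samePair x 1 9 y b d && samePair x 4 9 y c d &&
  labels.any fun e => samePair x 0 11 y a e && samePair x 1 11 y b e &&
    samePair x 4 11 y c e && samePair x 9 11 y d e

lemma isomorphic_of_isoSearch {x y : ℕ} (h : isoSearch x y = true) :
    (codeGraph x).Isomorphic (codeGraph y) := by
  have key {j k a b : Fin 5} (h : samePair x (vertexLabel j) (vertexLabel k) y (vertexLabel a)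
      (vertexLabel b) = true) : a ≠ b ∧ colorOf x (vertexLabel j) (vertexLabel k) =
      colorOf y (vertexLabel a) (vertexLabel b) := by
    simp only [samePair, Bool.and_eq_true, Bool.not_eq_true', Nat.beq_eq] at h
    exact ⟨fun hab => by simp [hab] at h, h.2⟩
  simp only [isoSearch, List.any_eq_true, Bool.and_eq_true] at h
  obtain ⟨a, ha, b, hb, h01, c, hc, ⟨h02, h12⟩, d, hd, ⟨⟨h03, h13⟩, h23⟩, e, he,
    ⟨⟨h04, h14⟩, h24⟩, h34⟩ := h
  obtain ⟨a, rfl⟩ := mem_labels ha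
  obtain ⟨b, rfl⟩ := mem_labels hb
  obtain ⟨c, rfl⟩ := mem_labels hc
  obtain ⟨d, rfl⟩ := mem_labels hd
  obtain ⟨e, rfl⟩ := mem_labels he
  have k01 := key (j := 0) (k := 1) h01
  have k02 := key (j := 0) (k := 2) h02
  have k12 := key (j := 1) (k := 2) h12
  have k03 := key (j := 0) (k := 3) h03
  have k13 := key (j := 1) (k := 3) h13
  have k23 := key (j := 2) (k := 3) h23
  have k04 := key (j := 0) (k := 4) h04
  have k14 := key (j := 1) (k := 4) h14
  have k24 := key (j := 2) (k := 4) h24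
  have k34 := key (j := 3) (k := 4) h34
  set f : Fin 5 → Fin 5 := ![a, b, c, d, e] with hf
  have hlt : ∀ j k, j < k → f j ≠ f k ∧ colorOf x (vertexLabel j) (vertexLabel k) =
      colorOf y (vertexLabel (f j)) (vertexLabel (f k)) := by
    intro j k hjk
    fin_cases j <;> fin_cases k <;> first | exact absurd hjk (by decide) | assumption
  have hne : ∀ j k, j ≠ k → f j ≠ f k ∧ colorOf x (vertexLabel j) (vertexLabel k) =
      colorOf y (vertexLabel (f j)) (vertexLabel (f k)) := by
    intro j k hjk
    rcases lt_or_gt_of_ne hjk with h | h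
    · exact hlt j k h
    · rw [colorOf_comm x, colorOf_comm y]
      exact ⟨(hlt k j h).1.symm, (hlt k j h).2⟩
  have hinj : Function.Injective f := fun j k h => by
    by_contra hjk
    exact (hne j k hjk).1 h
  refine ⟨Equiv.ofBijective f (Finite.injective_iff_bijective.1 hinj), fun i j k => ?_⟩
  change (j ≠ k ∧ _ = _) ↔ (f j ≠ f k ∧ _ = _)
  rw [hinj.ne_iff]
  refine and_congr_right fun hjk => ?_
  rw [(hne j k hjk).2]
  rfl

/-- All colourings with `a`, `b`, `c` further pairs of colour `0`, `1`, `2` at the positions `l`,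
added to the code `x`, satisfy `P`. -/
def allCodes (P : ℕ → Bool) : List ℕ → ℕ → ℕ → ℕ → ℕ → Bool
  | [], _, _, _, x => P x
  | e :: l, a, b, c, x => (Nat.beq a 0 || allCodes P l (a - 1) b c x) &&
    (Nat.beq b 0 || allCodes P l a (b - 1) c (Nat.add x (Nat.pow 10 e))) &&
    (Nat.beq c 0 || allCodes P l a b (c - 1) (Nat.add x (Nat.mul 2 (Nat.pow 10 e))))

/-- The code with the given colours at the given positions. -/
def codeSum (w : List (ℕ × Fin 3)) : ℕ := (w.map fun p => (p.2 : ℕ) * 10 ^ p.1).sum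

lemma codeSum_nil : codeSum [] = 0 := rfl

lemma codeSum_cons (e : ℕ) (c : Fin 3) (w : List (ℕ × Fin 3)) :
    codeSum ((e, c) :: w) = c * 10 ^ e + codeSum w := List.sum_cons

lemma of_allCodes {P : ℕ → Bool} (w : List (ℕ × Fin 3)) {a b c x : ℕ}
    (h : allCodes P (w.map Prod.fst) a b c x = true)
    (ha : w.countP (fun p => p.2 = 0) = a) (hb : w.countP (fun p => p.2 = 1) = b)
    (hc : w.countP (fun p => p.2 = 2) = c) :
    P (x + codeSum w) = true := by
  induction w generalizing a b c x with
  | nil => simpa [allCodes, codeSum_nil] using h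
  | cons p w ih =>
    obtain ⟨e, q⟩ := p
    simp only [List.map_cons, allCodes, Bool.and_eq_true, Bool.or_eq_true, Nat.beq_eq] at h
    obtain ⟨⟨h0, h1⟩, h2⟩ := h
    subst ha hb hc
    rw [codeSum_cons, ← add_assoc]
    fin_cases q
    · simp only [List.countP_cons] at h0
      simpa using ih (h0.resolve_left (by simp)) (by simp) (by simp) (by simp)
    · simp only [List.countP_cons] at h1
      simpa using ih (h1.resolve_left (by simp)) (by simp) (by simp) (by simp)
    · simp only [List.countP_cons] at h2
      simpa using ih (h2.resolve_left (by simp)) (by simp) (by simp) (by simp)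

/-- Search for an isomorphic graph in the table. -/
def tableSearch (x : ℕ) : Bool :=
  graphTable.any fun y => Nat.beq (graphInvariant x) (graphInvariant y.1) && isoSearch x y.1

set_option maxRecDepth 100000 in
lemma allCodes_tableSearch :
    allCodes tableSearch [20, 15, 13, 12, 11, 10, 9, 5, 4, 1] 5 3 2 0 = true := by
  decide +kernel

/-- Sum over the pairs of vertices. -/
def pairSum (f : Fin 5 → Fin 5 → ℕ) : ℕ :=
  f 0 1 + f 0 2 + f 0 3 + f 0 4 + f 1 2 + f 1 3 + f 1 4 + f 2 3 + f 2 4 + f 3 4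

lemma ncard_edgeSet_eq_pairSum (H : SimpleGraph (Fin 5)) [DecidableRel H.Adj] :
    H.edgeSet.ncard = pairSum fun j k => if H.Adj j k then 1 else 0 := by
  have h := H.sum_degrees_eq_twice_card_edges
  rw [← SimpleGraph.coe_edgeFinset, Set.ncard_coe_finset]
  simp only [← SimpleGraph.card_neighborFinset_eq_degree,
    SimpleGraph.neighborFinset_eq_filter, Finset.card_filter, Fin.sum_univ_five,
    SimpleGraph.irrefl, if_false, H.adj_comm 1 0, H.adj_comm 2 0, H.adj_comm 2 1, H.adj_comm 3 0,
    H.adj_comm 3 1, H.adj_comm 3 2, H.adj_comm 4 0, H.adj_comm 4 1, H.adj_comm 4 2,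
    H.adj_comm 4 3] at h
  simp only [pairSum]
  omega

lemma ncard_edgeSet_codeGraph {x : ℕ} (hx : x ∈ graphTable.map Prod.fst) (i : Fin 3) :
    (codeGraph x i).edgeSet.ncard = ![5, 3, 2] i := by
  have : DecidableRel (codeGraph x i).Adj := fun j k => inferInstanceAs (Decidable (_ ∧ _))
  have key : ∀ x ∈ graphTable.map Prod.fst, ∀ i : Fin 3,
      (pairSum fun j k => if j ≠ k ∧ colorOf x (vertexLabel j) (vertexLabel k) = i then 1 else 0) =
        ![5, 3, 2] i := by decide +kernel
  rw [ncard_edgeSet_eq_pairSum, ← key x hx i]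
  exact congrArg pairSum (funext₂ fun j k => if_congr Iff.rfl rfl rfl)

lemma isCode_of_mem {x : ℕ} (hx : x ∈ graphTable.map Prod.fst) : IsCode x := by
  have key : ∀ x ∈ graphTable.map Prod.fst, IsCode x := by decide +kernel
  exact key x hx

lemma ColoredGraph.Isomorphic.ncard_edgeSet {m n : ℕ} {G G' : ColoredGraph m n}
    (h : G.Isomorphic G') (i : Fin m) : (G i).edgeSet.ncard = (G' i).edgeSet.ncard := by
  obtain ⟨σ, hσ⟩ := h
  let e : G i ≃g G' i := ⟨σ, fun {j k} => (hσ i j k).symm⟩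
  rw [← Nat.card_coe_set_eq, ← Nat.card_coe_set_eq]
  exact Nat.card_congr e.mapEdgeSet

lemma ColoredGraph.Isomorphic.symm {m n : ℕ} {G G' : ColoredGraph m n}
    (h : G.Isomorphic G') : G'.Isomorphic G := by
  obtain ⟨σ, hσ⟩ := h
  exact ⟨σ.symm, fun i j k => by simp [hσ]⟩

lemma digits_eq {x c34 c24 c23 c14 c04 c13 c03 c12 c02 c01 : ℕ} (h34 : c34 < 3) (h24 : c24 < 3)
    (h23 : c23 < 3) (h14 : c14 < 3) (h04 : c04 < 3) (h13 : c13 < 3) (h03 : c03 < 3)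
    (h12 : c12 < 3) (h02 : c02 < 3) (h01 : c01 < 3)
    (hx : x = 0 + (c34 * 10 ^ 20 + (c24 * 10 ^ 15 + (c23 * 10 ^ 13 + (c14 * 10 ^ 12 +
      (c04 * 10 ^ 11 + (c13 * 10 ^ 10 + (c03 * 10 ^ 9 + (c12 * 10 ^ 5 + (c02 * 10 ^ 4 +
      (c01 * 10 ^ 1 + 0))))))))))) :
    x / 10 ^ 20 % 10 = c34 ∧ x / 10 ^ 15 % 10 = c24 ∧ x / 10 ^ 13 % 10 = c23 ∧
      x / 10 ^ 12 % 10 = c14 ∧ x / 10 ^ 11 % 10 = c04 ∧ x / 10 ^ 10 % 10 = c13 ∧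
      x / 10 ^ 9 % 10 = c03 ∧ x / 10 ^ 5 % 10 = c12 ∧ x / 10 ^ 4 % 10 = c02 ∧
      x / 10 ^ 1 % 10 = c01 := by
  simp only [Nat.reducePow] at *
  refine ⟨?_, ?_, ?_, ?_, ?_, ?_, ?_, ?_, ?_, ?_⟩ <;> omega

/-- A colouring of the pairs of vertices with five, three and two pairs of the three colours is
isomorphic to one in the table. -/
theorem exists_isomorphic_codeGraph {G : ColoredGraph 3 5}
    (hcov : ∀ j k, j ≠ k → ∃ i, (G i).Adj j k)
    (hcard : ∀ i, (G i).edgeSet.ncard = ![5, 3, 2] i) :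
    ∃ y ∈ graphTable.map Prod.fst, G.Isomorphic (codeGraph y) := by
  classical
  let n (j k : Fin 5) : ℕ := ∑ i, if (G i).Adj j k then 1 else 0
  have hcov' (j k : Fin 5) (hjk : j ≠ k) : 1 ≤ n j k := by
    obtain ⟨i, hi⟩ := hcov j k hjk
    calc 1 = if (G i).Adj j k then 1 else 0 := by simp [hi]
      _ ≤ n j k := Finset.single_le_sum (f := fun i => if (G i).Adj j k then 1 else 0)
        (fun _ _ => Nat.zero_le _) (Finset.mem_univ i)
  have hcount (i : Fin 3) := (ncard_edgeSet_eq_pairSum (G i)).symm.trans (hcard i)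
  have hsum : pairSum n = 10 := by
    have h0 := hcount 0
    have h1 := hcount 1
    have h2 := hcount 2
    simp only [pairSum, Matrix.cons_val] at h0 h1 h2
    simp only [pairSum, n, Fin.sum_univ_three]
    omega
  have hone (j k : Fin 5) (hjk : j < k) : n j k = 1 := by
    have h01 := hcov' 0 1 (by decide)
    have h02 := hcov' 0 2 (by decide)
    have h03 := hcov' 0 3 (by decide)
    have h04 := hcov' 0 4 (by decide)
    have h12 := hcov' 1 2 (by decide)
    have h13 := hcov' 1 3 (by decide)
    have h14 := hcov' 1 4 (by decide)
    have h23 := hcov' 2 3 (by decide)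
    have h24 := hcov' 2 4 (by decide)
    have h34 := hcov' 3 4 (by decide)
    simp only [pairSum] at hsum
    clear_value n
    fin_cases j <;> fin_cases k <;> first | exact absurd hjk (by decide) | (simp; omega)
  have hcol (j k : Fin 5) (hjk : j < k) : ∃ c, ∀ i, (G i).Adj j k ↔ c = i := by
    obtain ⟨c, hc⟩ := hcov j k hjk.ne
    refine ⟨c, fun i => ⟨fun hi => ?_, fun h => h ▸ hc⟩⟩
    by_contra hci
    have := hone j k hjk
    have h2 : ∑ i ∈ {c, i}, (if (G i).Adj j k then 1 else 0) ≤ n j k :=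
      Finset.sum_le_sum_of_subset (Finset.subset_univ _)
    rw [Finset.sum_pair hci, if_pos hc, if_pos hi] at h2
    omega
  obtain ⟨c01, k01⟩ := hcol 0 1 (by decide)
  obtain ⟨c02, k02⟩ := hcol 0 2 (by decide)
  obtain ⟨c03, k03⟩ := hcol 0 3 (by decide)
  obtain ⟨c04, k04⟩ := hcol 0 4 (by decide)
  obtain ⟨c12, k12⟩ := hcol 1 2 (by decide)
  obtain ⟨c13, k13⟩ := hcol 1 3 (by decide)
  obtain ⟨c14, k14⟩ := hcol 1 4 (by decide)
  obtain ⟨c23, k23⟩ := hcol 2 3 (by decide)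
  obtain ⟨c24, k24⟩ := hcol 2 4 (by decide)
  obtain ⟨c34, k34⟩ := hcol 3 4 (by decide)
  set w : List (ℕ × Fin 3) := [(20, c34), (15, c24), (13, c23), (12, c14), (11, c04), (10, c13),
    (9, c03), (5, c12), (4, c02), (1, c01)] with hw
  have hwcount (i : Fin 3) : w.countP (fun p => p.2 = i) = ![5, 3, 2] i := by
    rw [← hcount i]
    simp only [hw, List.countP_cons, List.countP_nil, pairSum, k01, k02, k03, k04, k12, k13, k14,
      k23, k24, k34, decide_eq_true_eq]
    omega
  have hfst : w.map Prod.fst = [20, 15, 13, 12, 11, 10, 9, 5, 4, 1] := rfl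
  have hc0 : w.countP (fun p => p.2 = 0) = 5 := hwcount 0
  have hc1 : w.countP (fun p => p.2 = 1) = 3 := hwcount 1
  have hc2 : w.countP (fun p => p.2 = 2) = 2 := hwcount 2
  obtain ⟨x, hx⟩ : ∃ x, x = 0 + codeSum w := ⟨_, rfl⟩
  have hP : tableSearch x = true := by
    rw [hx]
    exact of_allCodes w (hfst ▸ allCodes_tableSearch) hc0 hc1 hc2
  rw [hw] at hx
  simp only [codeSum_cons, codeSum_nil] at hx
  obtain ⟨d34, d24, d23, d14, d04, d13, d03, d12, d02, d01⟩ := digits_eq c34.2 c24.2 c23.2 c14.2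
    c04.2 c13.2 c03.2 c12.2 c02.2 c01.2 hx
  simp only [tableSearch, List.any_eq_true, Bool.and_eq_true] at hP
  obtain ⟨y, hy, -, hiso⟩ := hP
  refine ⟨y.1, List.mem_map_of_mem hy, ?_⟩
  obtain ⟨σ, hσ⟩ := isomorphic_of_isoSearch hiso
  refine ⟨σ, fun i j k => ?_⟩
  rw [← hσ]
  have hlt (j k : Fin 5) (hjk : j < k) : (G i).Adj j k ↔ (codeGraph x i).Adj j k := by
    have key {c : Fin 3} {a b : Fin 5} {e : ℕ} (hab : a < b) (h : ∀ i, (G i).Adj a b ↔ c = i)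
        (h' : x / 10 ^ e % 10 = c) (he : vertexLabel a + vertexLabel b = e) :
        (G i).Adj a b ↔ (codeGraph x i).Adj a b := by
      subst he
      rw [h, Fin.ext_iff, ← h', ← colorOf_eq]
      exact ⟨fun e => ⟨hab.ne, e⟩, fun e => e.2⟩
    fin_cases j <;> fin_cases k <;> first
      | exact absurd hjk (by decide)
      | exact key hjk k01 d01 rfl
      | exact key hjk k02 d02 rfl
      | exact key hjk k03 d03 rfl
      | exact key hjk k04 d04 rfl
      | exact key hjk k12 d12 rfl
      | exact key hjk k13 d13 rfl
      | exact key hjk k14 d14 rfl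
      | exact key hjk k23 d23 rfl
      | exact key hjk k24 d24 rfl
      | exact key hjk k34 d34 rfl
  rcases lt_trichotomy j k with h | h | h
  · exact hlt j k h
  · simp [h]
  · rw [SimpleGraph.adj_comm, hlt k j h, SimpleGraph.adj_comm]

/-- Every graph has unit vectors in some `ℂ^d` which are orthogonal exactly when adjacent. -/
lemma exists_orthogonal_representation {n : ℕ} (H : SimpleGraph (Fin n)) :
    ∃ (d : ℕ) (v : Fin n → EuclideanSpace ℂ (Fin d)), (∀ j, ‖v j‖ = 1) ∧
      ∀ j k, j ≠ k → (inner ℂ (v j) (v k) = 0 ↔ H.Adj j k) := by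
  classical
  let e := Fintype.equivFin (Sym2 (Fin n))
  let u (j : Fin n) : EuclideanSpace ℂ (Fin (Fintype.card (Sym2 (Fin n)))) :=
    WithLp.toLp 2 fun x => if j ∈ e.symm x ∧ e.symm x ∉ H.edgeSet then 1 else 0
  have hinner (j k : Fin n) : inner ℂ (u j) (u k) =
      ((∑ x, if (j ∈ e.symm x ∧ k ∈ e.symm x) ∧ e.symm x ∉ H.edgeSet then 1 else 0 : ℕ) : ℂ) := by
    simp only [PiLp.inner_apply, u, RCLike.inner_apply, Nat.cast_sum]
    refine Finset.sum_congr rfl fun x _ => ?_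
    by_cases h1 : j ∈ e.symm x <;> by_cases h2 : k ∈ e.symm x <;>
      by_cases h3 : e.symm x ∈ H.edgeSet <;> simp [h1, h2, h3]
  have hzero (j k : Fin n) : inner ℂ (u j) (u k) = 0 ↔
      ∀ s : Sym2 (Fin n), j ∈ s → k ∈ s → s ∈ H.edgeSet := by
    rw [hinner, Nat.cast_eq_zero, Finset.sum_eq_zero_iff]
    constructor
    · intro h s hj hk
      by_contra hs
      have := h (e s) (Finset.mem_univ _)
      simp [hj, hk, hs] at this
    · intro h x _
      rw [if_neg]
      rintro ⟨⟨hj, hk⟩, hs⟩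
      exact hs (h _ hj hk)
  have hne (j : Fin n) : u j ≠ 0 := by
    intro h
    have := (hzero j j).1 (by rw [h, inner_zero_left]) s(j, j) (by simp) (by simp)
    simp at this
  refine ⟨_, fun j => ((‖u j‖⁻¹ : ℝ) : ℂ) • u j, fun j => ?_, fun j k hjk => ?_⟩
  · rw [norm_smul, Complex.norm_real, norm_inv, norm_norm,
      inv_mul_cancel₀ (norm_ne_zero_iff.2 (hne j))]
  · rw [inner_smul_left, inner_smul_right, mul_eq_zero, mul_eq_zero, map_eq_zero,
      Complex.ofReal_eq_zero, inv_eq_zero, norm_eq_zero, Complex.ofReal_eq_zero, inv_eq_zero,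
      norm_eq_zero]
    simp only [hne, false_or, hzero]
    constructor
    · exact fun h => h s(j, k) (by simp) (by simp)
    · intro h s hj hk
      rwa [(Sym2.mem_and_mem_iff hjk).1 ⟨hj, hk⟩]

lemma IsOPS.exists_adj {m n : ℕ} {d : Fin m → ℕ} {φ : LocalVectors d n} (h : IsOPS φ)
    {j k : Fin n} (hjk : j ≠ k) : ∃ i, (orthGraph φ i).Adj j k := by
  have := h.orthogonal j k hjk
  rw [inner_productKet, Finset.prod_eq_zero_iff] at this
  obtain ⟨i, -, hi⟩ := this
  exact ⟨i, hjk, hi⟩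

lemma isOPS_of_forall_adj {m n : ℕ} {d : Fin m → ℕ} {φ : LocalVectors d n}
    (hφ : ∀ j i, ‖φ j i‖ = 1) (h : ∀ j k, j ≠ k → ∃ i, (orthGraph φ i).Adj j k) : IsOPS φ where
  norm_eq_one := hφ
  orthogonal j k hjk := by
    obtain ⟨i, hi⟩ := h j k hjk
    rw [inner_productKet]
    exact Finset.prod_eq_zero (Finset.mem_univ i) hi.2

lemma exists_localVectors {m n : ℕ} (G : ColoredGraph m n)
    (h : ∀ j k, j ≠ k → ∃ i, (G i).Adj j k) :
    ∃ (d : Fin m → ℕ) (φ : LocalVectors d n), IsOPS φ ∧ orthGraph φ = G := by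
  choose d v hv horth using fun i => exists_orthogonal_representation (G i)
  have hG : orthGraph (d := d) (fun j i => v i j) = G := by
    funext i
    ext j k
    change (j ≠ k ∧ _) ↔ _
    exact ⟨fun h => (horth i j k h.1).1 h.2, fun h => ⟨h.ne, (horth i j k h.ne).2 h⟩⟩
  exact ⟨d, fun j i => v i j, isOPS_of_forall_adj (fun j i => hv i j) (by rwa [hG]), hG⟩

/-- The thirty orthogonality graphs. -/
def orthogonalityGraphs (r : Fin 30) : ColoredGraph 3 5 :=
  codeGraph ((graphTable.map Prod.fst)[r])

lemma isOrthGraphWithVector_iff (G : ColoredGraph 3 5) :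
    IsOrthGraphWithVector G ![5, 3, 2] ↔ ∃ r, G.Isomorphic (orthogonalityGraphs r) := by
  constructor
  · rintro ⟨d, φ, hφ, hv, rfl⟩
    obtain ⟨y, hy, h⟩ := exists_isomorphic_codeGraph (fun j k => hφ.exists_adj) (congrFun hv)
    obtain ⟨r, hr, rfl⟩ := List.mem_iff_getElem.1 hy
    exact ⟨⟨r, hr⟩, h⟩
  · rintro ⟨r, h⟩
    have hmem : (graphTable.map Prod.fst)[r] ∈ graphTable.map Prod.fst := List.getElem_mem _
    obtain ⟨d, φ, hφ, hG⟩ := exists_localVectors G fun j k hjk => by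
      obtain ⟨σ, hσ⟩ := h
      exact ⟨⟨_, (isCode_of_mem hmem (σ j) (σ k)).1⟩,
        (hσ _ j k).2 ⟨fun h => hjk (σ.injective h), rfl⟩⟩
    refine ⟨d, φ, hφ, funext fun i => ?_, hG⟩
    rw [orthVector, hG, h.ncard_edgeSet]
    exact ncard_edgeSet_codeGraph hmem i

lemma orthogonalityGraphs_injective {r s : Fin 30}
    (h : (orthogonalityGraphs r).Isomorphic (orthogonalityGraphs s)) : r = s := by
  have key : ∀ r s : Fin 30, graphInvariant (graphTable.map Prod.fst)[r] =
      graphInvariant (graphTable.map Prod.fst)[s] → r = s := by decide +kernel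
  exact key r s (graphInvariant_eq (isCode_of_mem (List.getElem_mem _))
    (isCode_of_mem (List.getElem_mem _)) h)

lemma orthogonalityGraphs_star : orthogonalityGraphs 25 = starMatchingGraph := by
  have key : ∀ j k : Fin 5, ((colorOf 1201000210000 (vertexLabel j) (vertexLabel k) = 0 ∧ j ≠ k) ↔
      s(j, k) ∈ ({s(3, 1), s(3, 2), s(3, 4), s(0, 1), s(2, 4)} : Finset _) ∧ j ≠ k) ∧
      ((colorOf 1201000210000 (vertexLabel j) (vertexLabel k) = 1 ∧ j ≠ k) ↔
      s(j, k) ∈ ({s(0, 3), s(0, 2), s(1, 4)} : Finset _) ∧ j ≠ k) ∧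
      ((colorOf 1201000210000 (vertexLabel j) (vertexLabel k) = 2 ∧ j ≠ k) ↔
      s(j, k) ∈ ({s(0, 4), s(1, 2)} : Finset _) ∧ j ≠ k) := by decide +kernel
  funext i
  ext j k
  obtain ⟨h0, h1, h2⟩ := key j k
  simp only [Finset.mem_insert, Finset.mem_singleton] at h0 h1 h2
  change (j ≠ k ∧ colorOf 1201000210000 (vertexLabel j) (vertexLabel k) = i) ↔ _
  rw [and_comm]
  fin_cases i
  · simpa [starMatchingGraph] using h0
  · simpa [starMatchingGraph] using h1
  · simpa [starMatchingGraph] using h2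

lemma orthogonalityGraphs_pentagon : orthogonalityGraphs 29 = pentagonGraph := by
  have key : ∀ j k : Fin 5,
      ((colorOf 100002000020000010010 (vertexLabel j) (vertexLabel k) = 0 ∧ j ≠ k) ↔
      s(j, k) ∈ ({s(0, 3), s(3, 2), s(2, 1), s(1, 4), s(4, 0)} : Finset _) ∧ j ≠ k) ∧
      ((colorOf 100002000020000010010 (vertexLabel j) (vertexLabel k) = 1 ∧ j ≠ k) ↔
      s(j, k) ∈ ({s(0, 1), s(0, 2), s(3, 4)} : Finset _) ∧ j ≠ k) ∧
      ((colorOf 100002000020000010010 (vertexLabel j) (vertexLabel k) = 2 ∧ j ≠ k) ↔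
      s(j, k) ∈ ({s(1, 3), s(2, 4)} : Finset _) ∧ j ≠ k) := by decide +kernel
  funext i
  ext j k
  obtain ⟨h0, h1, h2⟩ := key j k
  simp only [Finset.mem_insert, Finset.mem_singleton] at h0 h1 h2
  change (j ≠ k ∧ colorOf 100002000020000010010 (vertexLabel j) (vertexLabel k) = i) ↔ _
  rw [and_comm]
  fin_cases i
  · simpa [pentagonGraph] using h0
  · simpa [pentagonGraph] using h1
  · simpa [pentagonGraph] using h2

lemma ncard_edgeSet_orthogonalityGraphs (r : Fin 30) (i : Fin 3) :
    (orthogonalityGraphs r i).edgeSet.ncard = ![5, 3, 2] i :=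
  ncard_edgeSet_codeGraph (List.getElem_mem _) i

/-- Outside the two special graphs the tabulated strategies win. -/
theorem distinguishable_of_not_isomorphic {d : Fin 3 → ℕ} {φ : LocalVectors d 5} (hφ : IsOPS φ)
    (hv : orthVector φ = ![5, 3, 2]) (hs : ¬ (orthGraph φ).Isomorphic starMatchingGraph)
    (hp : ¬ (orthGraph φ).Isomorphic pentagonGraph) : LOCCDistinguishable φ := by
  obtain ⟨r, hr⟩ := (isOrthGraphWithVector_iff _).1 ⟨d, φ, hφ, hv, rfl⟩
  have key : ∀ r : Fin 30, r = 25 ∨ r = 29 ∨ ∃ T, graphTable[r].2 = some T ∧ T.wins (fun _ => true)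
      (fun i j k => decide (j ≠ k ∧ colorOf (graphTable.map Prod.fst)[r] (vertexLabel j)
        (vertexLabel k) = i)) = true := by
    have : ∀ r : Fin 30, r = 25 ∨ r = 29 ∨ (graphTable[r].2.any fun T => T.wins (fun _ => true)
      (fun i j k => decide (j ≠ k ∧ colorOf (graphTable.map Prod.fst)[r] (vertexLabel j)
        (vertexLabel k) = i))) = true := by decide +kernel
    intro r
    simpa only [Option.any_eq_true] using this r
  rcases key r with rfl | rfl | ⟨T, -, hT⟩
  · exact absurd (orthogonalityGraphs_star ▸ hr) hs
  · exact absurd (orthogonalityGraphs_pentagon ▸ hr) hp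
  · obtain ⟨σ, hσ⟩ := hr
    refine .of_wins hφ.norm_eq_one T hT σ fun i a b h => ?_
    have hadj := of_decide_eq_true h
    exact ((hσ i a b).2 hadj).2

lemma invSqrt_ne_zero {k : ℕ} (hk : k ≠ 0) : invSqrt k ≠ 0 := by
  have : (0 : ℝ) < k := by positivity
  rw [invSqrt, Complex.ofReal_ne_zero]
  positivity

lemma invSqrt_one : invSqrt 1 = 1 := by simp [invSqrt]

/-- The vector `u`, divided by `√k`. -/
def unitVec {d : ℕ} (k : ℕ) (u : Fin d → ℂ) : EuclideanSpace ℂ (Fin d) :=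
  invSqrt k • WithLp.toLp 2 u

/-- The vector with integral entries `z`, divided by `√k`. -/
def intVec {d : ℕ} (k : ℕ) (z : Fin d → ℤ) : EuclideanSpace ℂ (Fin d) :=
  unitVec k fun x => (z x : ℂ)

lemma norm_unitVec {d k : ℕ} (hk : k ≠ 0) {u : Fin d → ℂ} (h : ∑ x, ‖u x‖ ^ 2 = k) :
    ‖unitVec k u‖ = 1 := by
  have hk' : (0 : ℝ) < k := by positivity
  rw [unitVec, norm_smul, EuclideanSpace.norm_eq, h, invSqrt, Complex.norm_real, Real.norm_eq_abs,
    abs_of_pos (by positivity), one_div, inv_mul_cancel₀ (by positivity)]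

lemma norm_intVec {d k : ℕ} (hk : k ≠ 0) {z : Fin d → ℤ} (h : ∑ x, z x ^ 2 = k) :
    ‖intVec k z‖ = 1 := by
  refine norm_unitVec hk ?_
  simp only [Complex.norm_intCast, sq_abs]
  exact_mod_cast h

lemma inner_act_unitVec_eq_zero_iff {d k l : ℕ} (hk : k ≠ 0) (hl : l ≠ 0)
    (B : Matrix (Fin d) (Fin d) ℂ) (u v : Fin d → ℂ) :
    inner ℂ (act B (unitVec k u)) (act B (unitVec l v)) = 0 ↔
      star u ⬝ᵥ ((Bᴴ * B) *ᵥ v) = 0 := by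
  rw [inner_act_act, unitVec, unitVec, WithLp.ofLp_smul, WithLp.ofLp_smul, star_smul,
    Matrix.mulVec_smul, smul_dotProduct, dotProduct_smul, smul_eq_mul, smul_eq_mul,
    mul_eq_zero, mul_eq_zero, star_eq_zero]
  simp [invSqrt_ne_zero hk, invSqrt_ne_zero hl]

lemma inner_unitVec_eq_zero_iff {d k l : ℕ} (hk : k ≠ 0) (hl : l ≠ 0) (u v : Fin d → ℂ) :
    inner ℂ (unitVec k u) (unitVec l v) = 0 ↔ star u ⬝ᵥ v = 0 := by
  simpa [act_one] using inner_act_unitVec_eq_zero_iff hk hl 1 u v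

lemma inner_intVec_eq_zero_iff {d k l : ℕ} (hk : k ≠ 0) (hl : l ≠ 0) (z w : Fin d → ℤ) :
    inner ℂ (intVec k z) (intVec l w) = 0 ↔ z ⬝ᵥ w = 0 := by
  rw [intVec, intVec, inner_unitVec_eq_zero_iff hk hl]
  simp only [dotProduct, Pi.star_apply, RCLike.star_def, map_intCast]
  norm_cast

lemma forall_fin_three {P : Fin 3 → Prop} (h0 : P 0) (h1 : P 1) (h2 : P 2) : ∀ i, P i
  | 0 => h0
  | 1 => h1
  | 2 => h2

lemma isOPS_and_orthVector {d : Fin 3 → ℕ} {φ : LocalVectors d 5} (hφ : ∀ j i, ‖φ j i‖ = 1)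
    {r : Fin 30} (h : orthGraph φ = orthogonalityGraphs r) :
    IsOPS φ ∧ orthVector φ = ![5, 3, 2] := by
  refine ⟨isOPS_of_forall_adj hφ fun j k hjk => ?_, funext fun i => ?_⟩
  · rw [h]
    exact ⟨⟨_, (isCode_of_mem (List.getElem_mem _) j k).1⟩, hjk, rfl⟩
  · rw [orthVector, h, ncard_edgeSet_orthogonalityGraphs]

lemma orthGraph_eq_orthogonalityGraphs {d : Fin 3 → ℕ} {φ : LocalVectors d 5} {r : Fin 30} {x : ℕ}
    (hr : (graphTable.map Prod.fst)[r] = x)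
    (h : ∀ i j k, j ≠ k → (inner ℂ (φ j i) (φ k i) = 0 ↔
      colorOf x (vertexLabel j) (vertexLabel k) = i)) :
    orthGraph φ = orthogonalityGraphs r := by
  subst hr
  funext i
  ext j k
  exact and_congr_right fun hjk => h i j k hjk

/-- The operators which preserve all inner products up to a common factor. -/
def IsScaledUnitary {d : ℕ} (A : Matrix (Fin d) (Fin d) ℂ) : Prop := ∃ c : ℂ, c ≠ 0 ∧ Aᴴ * A = c • 1

lemma isScaledUnitary_one {d : ℕ} : IsScaledUnitary (1 : Matrix (Fin d) (Fin d) ℂ) :=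
  ⟨1, one_ne_zero, by simp⟩

lemma inner_act_act_of_eq_smul {d : ℕ} {A : Matrix (Fin d) (Fin d) ℂ} {c : ℂ} (h : Aᴴ * A = c • 1)
    (u v : EuclideanSpace ℂ (Fin d)) : inner ℂ (act A u) (act A v) = c * inner ℂ u v := by
  rw [inner_act_act, h, Matrix.smul_mulVec, Matrix.one_mulVec, dotProduct_smul, smul_eq_mul,
    EuclideanSpace.inner_eq_star_dotProduct, dotProduct_comm]

lemma IsScaledUnitary.inner_act_act_ne_zero {d : ℕ} {A : Matrix (Fin d) (Fin d) ℂ}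
    (h : IsScaledUnitary A) {u v : EuclideanSpace ℂ (Fin d)} (huv : inner ℂ u v ≠ 0) :
    inner ℂ (act A u) (act A v) ≠ 0 := by
  obtain ⟨c, hc, h⟩ := h
  rw [inner_act_act_of_eq_smul h]
  exact mul_ne_zero hc huv

lemma IsScaledUnitary.act_ne_zero {d : ℕ} {A : Matrix (Fin d) (Fin d) ℂ}
    (h : IsScaledUnitary A) {u : EuclideanSpace ℂ (Fin d)} (hu : u ≠ 0) : act A u ≠ 0 := fun h0 =>
  h.inner_act_act_ne_zero (inner_self_ne_zero.2 hu) (by rw [h0, inner_zero_left])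

lemma isScaledUnitary_of_eq_smul {d : ℕ} {A : Matrix (Fin d) (Fin d) ℂ} {c : ℂ}
    (h : Aᴴ * A = c • 1) {t : EuclideanSpace ℂ (Fin d)} (ht : act A t ≠ 0) : IsScaledUnitary A := by
  refine ⟨c, fun hc => ht ?_, h⟩
  rw [← inner_self_eq_zero (𝕜 := ℂ), inner_act_act_of_eq_smul h, hc, zero_mul]

lemma gram_swap_eq_zero {d : ℕ} {B : Matrix (Fin d) (Fin d) ℂ} {x y : Fin d}
    (h : (Bᴴ * B) x y = 0) : (Bᴴ * B) y x = 0 := by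
  have := congrFun₂ (Matrix.isHermitian_conjTranspose_mul_self B) y x
  rw [Matrix.conjTranspose_apply, h, star_zero] at this
  exact this.symm

/-- An operator of a qubit which keeps the computational basis and the Hadamard basis orthogonal
is a scaled unitary. -/
lemma isScaledUnitary_of_two_bases {B : Matrix (Fin 2) (Fin 2) ℂ}
    (h1 : star ![1, 0] ⬝ᵥ ((Bᴴ * B) *ᵥ ![0, 1]) = 0)
    (h2 : star ![1, 1] ⬝ᵥ ((Bᴴ * B) *ᵥ ![1, -1]) = 0)
    {t : EuclideanSpace ℂ (Fin 2)} (ht : act B t ≠ 0) : IsScaledUnitary B := by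
  refine isScaledUnitary_of_eq_smul (c := (Bᴴ * B) 0 0) ?_ ht
  have hsw := gram_swap_eq_zero (B := B) (x := 0) (y := 1)
  generalize Bᴴ * B = E at h1 h2 hsw
  simp [Matrix.mulVec, dotProduct, Fin.sum_univ_two] at h1 h2
  have h3 := hsw h1
  ext x y
  fin_cases x <;> fin_cases y <;> simp [h1, h3]
  linear_combination -h2 - h1 + h3

lemma isScaledUnitary_of_pentagon {B : Matrix (Fin 3) (Fin 3) ℂ}
    (h03 : star ![1, 0, 0] ⬝ᵥ ((Bᴴ * B) *ᵥ ![0, 1, 0]) = 0)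
    (h32 : star ![0, 1, 0] ⬝ᵥ ((Bᴴ * B) *ᵥ ![1, 0, 1]) = 0)
    (h21 : star ![1, 0, 1] ⬝ᵥ ((Bᴴ * B) *ᵥ ![1, 1, -1]) = 0)
    (h14 : star ![1, 1, -1] ⬝ᵥ ((Bᴴ * B) *ᵥ ![0, 1, 1]) = 0)
    (h04 : star ![1, 0, 0] ⬝ᵥ ((Bᴴ * B) *ᵥ ![0, 1, 1]) = 0)
    {t : EuclideanSpace ℂ (Fin 3)} (ht : act B t ≠ 0) : IsScaledUnitary B := by
  refine isScaledUnitary_of_eq_smul (c := (Bᴴ * B) 0 0) ?_ ht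
  have hsw {x y : Fin 3} := gram_swap_eq_zero (B := B) (x := x) (y := y)
  generalize Bᴴ * B = E at h03 h32 h21 h14 h04 hsw
  simp [Matrix.mulVec, dotProduct, Fin.sum_univ_three] at h03 h32 h21 h14 h04
  have h10 := hsw h03
  rw [h03, zero_add] at h04
  have h20 := hsw h04
  rw [h10, zero_add] at h32
  have h21' := hsw h32
  simp only [h03, h04, h32, h20, h21', zero_add, add_zero, neg_zero] at h21 h14
  ext x y
  fin_cases x <;> fin_cases y <;> simp [h03, h04, h32, h10, h20, h21']
  · linear_combination h14 - h21
  · linear_combination -h21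

/-- The operators of the first party which keep the star part of the first exceptional graph
orthogonal: they are scaled unitaries on the complement of the centre. -/
def IsScaledUnitaryOffCentre (A : Matrix (Fin 3) (Fin 3) ℂ) : Prop :=
  ∃ x y : ℂ, y ≠ 0 ∧ Aᴴ * A = Matrix.diagonal ![x, y, y]

lemma isScaledUnitaryOffCentre_of_star {B : Matrix (Fin 3) (Fin 3) ℂ}
    (h31 : star ![1, 0, 0] ⬝ᵥ ((Bᴴ * B) *ᵥ ![0, 1, 1]) = 0)
    (h32 : star ![1, 0, 0] ⬝ᵥ ((Bᴴ * B) *ᵥ ![0, 1, 0]) = 0)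
    (h01 : star ![1, 1, -1] ⬝ᵥ ((Bᴴ * B) *ᵥ ![0, 1, 1]) = 0)
    (h24 : star ![0, 1, 0] ⬝ᵥ ((Bᴴ * B) *ᵥ ![0, 0, 1]) = 0)
    (ht : star ![0, 1, 0] ⬝ᵥ ((Bᴴ * B) *ᵥ ![0, 1, 0]) ≠ 0) : IsScaledUnitaryOffCentre B := by
  refine ⟨(Bᴴ * B) 0 0, (Bᴴ * B) 1 1, ?_, ?_⟩
  · simpa [Matrix.mulVec, dotProduct, Fin.sum_univ_three] using ht
  have hsw {x y : Fin 3} := gram_swap_eq_zero (B := B) (x := x) (y := y)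
  generalize Bᴴ * B = E at h31 h32 h01 h24 hsw
  simp [Matrix.mulVec, dotProduct, Fin.sum_univ_three] at h31 h32 h01 h24
  have h10 := hsw h32
  rw [h32, zero_add] at h31
  have h20 := hsw h31
  have h21 := hsw h24
  simp only [h31, h32, h24, h21, zero_add, add_zero, neg_zero] at h01
  ext x y
  fin_cases x <;> fin_cases y <;> simp [h31, h32, h24, h10, h20, h21]
  linear_combination -h01

/-- Integral vectors of the three parties, to be normalised. -/
def intTriple {a b c : ℕ} (k : Fin 3 → ℕ) (u : Fin a → ℤ) (v : Fin b → ℤ) (w : Fin c → ℤ) :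
    (i : Fin 3) → EuclideanSpace ℂ (Fin (![a, b, c] i)) :=
  triple (intVec (k 0) u) (intVec (k 1) v) (intVec (k 2) w)

/-- The squared norms of the vectors of `starExample` before the normalisation. -/
def starNormSq : Fin 5 → Fin 3 → ℕ := ![![3, 1, 1], ![2, 2, 2], ![1, 1, 2], ![1, 1, 5], ![1, 2, 1]]

def starFirst : Fin 5 → Fin 3 → ℤ := ![![1, 1, -1], ![0, 1, 1], ![0, 1, 0], ![1, 0, 0], ![0, 0, 1]]

def starSecond : Fin 5 → Fin 2 → ℤ := ![![1, 0], ![1, 1], ![0, 1], ![0, 1], ![1, -1]]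

def starThird : Fin 5 → Fin 2 → ℤ := ![![1, 0], ![1, 1], ![1, -1], ![1, 2], ![0, 1]]

/-- Indistinguishable states whose orthogonality graph is the first exceptional graph. -/
def starExample : LocalVectors ![3, 2, 2] 5 := fun j =>
  intTriple (starNormSq j) (starFirst j) (starSecond j) (starThird j)

lemma starNormSq_ne_zero : ∀ j i, starNormSq j i ≠ 0 := by decide

lemma norm_starExample (j : Fin 5) (i : Fin 3) : ‖starExample j i‖ = 1 := by
  revert i
  refine forall_fin_three ?_ ?_ ?_ <;> refine norm_intVec (starNormSq_ne_zero _ _) ?_ <;>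
    revert j <;> decide

lemma orthGraph_starExample : orthGraph starExample = orthogonalityGraphs 25 := by
  refine orthGraph_eq_orthogonalityGraphs (x := 1201000210000) rfl ?_
  refine forall_fin_three ?_ ?_ ?_ <;> intro j k hjk <;>
    refine (inner_intVec_eq_zero_iff (starNormSq_ne_zero _ _) (starNormSq_ne_zero _ _) _ _).trans
      ?_ <;>
    revert j k <;> decide +kernel

/-- The pairs of states whose orthogonality on a subsystem restricts the operators there. -/
def starPairs : Fin 3 → List (Fin 5 × Fin 5) :=
  ![[(3, 1), (3, 2), (0, 1), (2, 4)], [(0, 2), (1, 4)], [(0, 4), (1, 2)]]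

lemma inner_act_intVec_eq_zero_iff {d k l : ℕ} (hk : k ≠ 0) (hl : l ≠ 0)
    (B : Matrix (Fin d) (Fin d) ℂ) (z w : Fin d → ℤ) :
    inner ℂ (act B (intVec k z)) (act B (intVec l w)) = 0 ↔
      star (fun x => (z x : ℂ)) ⬝ᵥ ((Bᴴ * B) *ᵥ fun x => (w x : ℂ)) = 0 :=
  inner_act_unitVec_eq_zero_iff hk hl _ _ _

lemma intCast_vec_two (a b : ℤ) : (fun x => ((![a, b] x : ℤ) : ℂ)) = ![(a : ℂ), (b : ℂ)] := by
  funext x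
  fin_cases x <;> rfl

lemma intCast_vec_three (a b c : ℤ) :
    (fun x => ((![a, b, c] x : ℤ) : ℂ)) = ![(a : ℂ), (b : ℂ), (c : ℂ)] := by
  funext x
  fin_cases x <;> rfl

/-- The operators which may occur in a protocol for `starExample`. -/
def starOperators : (i : Fin 3) → Matrix (Fin (![3, 2, 2] i)) (Fin (![3, 2, 2] i)) ℂ → Prop
  | 0 => fun A => IsScaledUnitaryOffCentre A
  | 1 => fun A => IsScaledUnitary A
  | 2 => fun A => IsScaledUnitary A

lemma isScaledUnitaryOffCentre_one : IsScaledUnitaryOffCentre 1 := by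
  refine ⟨1, 1, one_ne_zero, ?_⟩
  rw [Matrix.conjTranspose_one, one_mul]
  ext x y
  fin_cases x <;> fin_cases y <;> rfl

lemma IsScaledUnitaryOffCentre.inner_act_ne_zero {A : Matrix (Fin 3) (Fin 3) ℂ}
    (h : IsScaledUnitaryOffCentre A) {k l : ℕ} (hk : k ≠ 0) (hl : l ≠ 0) {z w : Fin 3 → ℤ}
    (h0 : z 0 * w 0 = 0) (h1 : z 1 * w 1 + z 2 * w 2 ≠ 0) :
    inner ℂ (act A (intVec k z)) (act A (intVec l w)) ≠ 0 := by
  obtain ⟨x, y, hy, h⟩ := h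
  rw [Ne, inner_act_intVec_eq_zero_iff hk hl, h]
  have h0' : (z 0 : ℂ) * w 0 = 0 := by exact_mod_cast h0
  have h1' : (z 1 : ℂ) * w 1 + z 2 * w 2 ≠ 0 := by exact_mod_cast h1
  have : star (fun x => (z x : ℂ)) ⬝ᵥ (Matrix.diagonal ![x, y, y] *ᵥ fun x => (w x : ℂ)) =
      y * ((z 1 : ℂ) * w 1 + z 2 * w 2) := by
    simp [dotProduct, Fin.sum_univ_three, Matrix.mulVec_diagonal]
    linear_combination x * h0'
  rw [this]
  exact mul_ne_zero hy h1'

lemma not_LOCCDistinguishable_starExample : ¬ LOCCDistinguishable starExample := by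
  have hpos := starNormSq_ne_zero
  have hadj (p : Fin 3) (j k : Fin 5) (h : (j, k) ∈ starPairs p) :
      j ≠ k ∧ ∀ i ≠ p, inner ℂ (starExample j i) (starExample k i) ≠ 0 := by
    have key : ∀ p, ∀ j k, (j, k) ∈ starPairs p → j ≠ k ∧ ∀ i : Fin 3, i ≠ p →
      colorOf 1201000210000 (vertexLabel j) (vertexLabel k) ≠ i := by decide +kernel
    obtain ⟨hjk, hi⟩ := key p j k h
    refine ⟨hjk, fun i hip h0 => hi i hip ?_⟩
    have : (orthGraph starExample i).Adj j k := ⟨hjk, h0⟩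
    rw [orthGraph_starExample] at this
    exact this.2
  have hne (j i) : starExample j i ≠ 0 := fun h => by
    have := norm_starExample j i
    rw [h, norm_zero] at this
    exact zero_ne_one this
  refine not_LOCCDistinguishable norm_starExample starOperators (starExample 2)
    (fun p j k => (j, k) ∈ starPairs p) (fun p j k h => (hadj p j k h).1) ?_ ?_ ?_ ?_
    (a := 1) (b := 2) (by decide) ?_
  · exact forall_fin_three isScaledUnitaryOffCentre_one isScaledUnitary_one isScaledUnitary_one
  · refine forall_fin_three (fun A hA h => ?_)
      (fun A hA => IsScaledUnitary.act_ne_zero hA (hne 2 1))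
      (fun A hA => IsScaledUnitary.act_ne_zero hA (hne 2 2))
    exact IsScaledUnitaryOffCentre.inner_act_ne_zero hA (hpos 2 0) (hpos 2 0) (z := starFirst 2)
      (w := starFirst 2) (by decide) (by decide) (inner_self_eq_zero.2 h)
  · refine forall_fin_three (fun A hA p j k hp h => ?_)
      (fun A hA p j k hp h => IsScaledUnitary.inner_act_act_ne_zero hA ((hadj p j k h).2 _ hp.symm))
      (fun A hA p j k hp h => IsScaledUnitary.inner_act_act_ne_zero hA ((hadj p j k h).2 _ hp.symm))
    have key : ∀ p : Fin 3, p ≠ 0 → ∀ j k, (j, k) ∈ starPairs p →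
        starFirst j 0 * starFirst k 0 = 0 ∧
        starFirst j 1 * starFirst k 1 + starFirst j 2 * starFirst k 2 ≠ 0 := by decide
    exact IsScaledUnitaryOffCentre.inner_act_ne_zero hA (hpos j 0) (hpos k 0)
      (key p hp j k h).1 (key p hp j k h).2
  · refine forall_fin_three (fun B h ht => ?_) (fun B h ht => ?_) (fun B h ht => ?_)
    · have e (j k) := fun hjk => (inner_act_intVec_eq_zero_iff (hpos j 0) (hpos k 0) B (starFirst j)
        (starFirst k)).1 (h j k hjk)
      have e31 := e 3 1 (by decide)
      have e32 := e 3 2 (by decide)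
      have e01 := e 0 1 (by decide)
      have e24 := e 2 4 (by decide)
      have e22 := mt (inner_act_intVec_eq_zero_iff (hpos 2 0) (hpos 2 0) B (starFirst 2)
        (starFirst 2)).2 fun h0 => ht (inner_self_eq_zero.1 h0)
      simp only [starFirst, Matrix.cons_val, intCast_vec_three, Int.cast_zero, Int.cast_one,
        Int.cast_neg] at e31 e32 e01 e24 e22
      exact isScaledUnitaryOffCentre_of_star e31 e32 e01 e24 e22
    · have e (j k) := fun hjk => (inner_act_intVec_eq_zero_iff (hpos j 1) (hpos k 1) B
        (starSecond j) (starSecond k)).1 (h j k hjk)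
      have e02 := e 0 2 (by decide)
      have e14 := e 1 4 (by decide)
      simp only [starSecond, Matrix.cons_val, intCast_vec_two, Int.cast_zero, Int.cast_one,
        Int.cast_neg] at e02 e14
      exact isScaledUnitary_of_two_bases e02 e14 ht
    · have e (j k) := fun hjk => (inner_act_intVec_eq_zero_iff (hpos j 2) (hpos k 2) B
        (starThird j) (starThird k)).1 (h j k hjk)
      have e04 := e 0 4 (by decide)
      have e12 := e 1 2 (by decide)
      simp only [starThird, Matrix.cons_val, intCast_vec_two, Int.cast_zero, Int.cast_one,
        Int.cast_neg] at e04 e12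
      exact isScaledUnitary_of_two_bases e04 e12 ht
  · refine forall_fin_three (fun A hA => ⟨fun h => ?_, fun h => ?_⟩)
      (fun A hA => ⟨IsScaledUnitary.act_ne_zero hA (hne _ _),
        IsScaledUnitary.act_ne_zero hA (hne _ _)⟩)
      (fun A hA => ⟨IsScaledUnitary.act_ne_zero hA (hne _ _),
        IsScaledUnitary.act_ne_zero hA (hne _ _)⟩)
    · exact IsScaledUnitaryOffCentre.inner_act_ne_zero hA (hpos 1 0) (hpos 1 0) (z := starFirst 1)
        (w := starFirst 1) (by decide) (by decide) (inner_self_eq_zero.2 h)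
    · exact IsScaledUnitaryOffCentre.inner_act_ne_zero hA (hpos 2 0) (hpos 2 0) (z := starFirst 2)
        (w := starFirst 2) (by decide) (by decide) (inner_self_eq_zero.2 h)

/-- The first local vectors of both examples for the second exceptional graph. -/
def pentagonFirst : Fin 5 → Fin 3 → ℤ :=
  ![![1, 0, 0], ![1, 1, -1], ![1, 0, 1], ![0, 1, 0], ![0, 1, 1]]

/-- The second local vectors of both examples for the second exceptional graph. -/
def pentagonSecond : Fin 5 → Fin 2 → ℤ := ![![1, 0], ![0, 1], ![0, 1], ![1, 1], ![1, -1]]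

def pentagonFirstNormSq : Fin 5 → ℕ := ![1, 3, 2, 1, 2]

def pentagonSecondNormSq : Fin 5 → ℕ := ![1, 1, 1, 2, 2]

lemma pentagonFirstNormSq_ne_zero : ∀ j, pentagonFirstNormSq j ≠ 0 := by decide

lemma pentagonSecondNormSq_ne_zero : ∀ j, pentagonSecondNormSq j ≠ 0 := by decide

lemma norm_pentagonFirst (j : Fin 5) : ‖intVec (pentagonFirstNormSq j) (pentagonFirst j)‖ = 1 :=
  norm_intVec (pentagonFirstNormSq_ne_zero j) (by revert j; decide)

lemma norm_pentagonSecond (j : Fin 5) :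
    ‖intVec (pentagonSecondNormSq j) (pentagonSecond j)‖ = 1 :=
  norm_intVec (pentagonSecondNormSq_ne_zero j) (by revert j; decide)

lemma inner_pentagonFirst (j k : Fin 5) (hjk : j ≠ k) :
    inner ℂ (intVec (pentagonFirstNormSq j) (pentagonFirst j))
      (intVec (pentagonFirstNormSq k) (pentagonFirst k)) = 0 ↔
      colorOf 100002000020000010010 (vertexLabel j) (vertexLabel k) = 0 := by
  rw [inner_intVec_eq_zero_iff (pentagonFirstNormSq_ne_zero j) (pentagonFirstNormSq_ne_zero k)]
  revert j k
  decide +kernel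

lemma inner_pentagonSecond (j k : Fin 5) (hjk : j ≠ k) :
    inner ℂ (intVec (pentagonSecondNormSq j) (pentagonSecond j))
      (intVec (pentagonSecondNormSq k) (pentagonSecond k)) = 0 ↔
      colorOf 100002000020000010010 (vertexLabel j) (vertexLabel k) = 1 := by
  rw [inner_intVec_eq_zero_iff (pentagonSecondNormSq_ne_zero j) (pentagonSecondNormSq_ne_zero k)]
  revert j k
  decide +kernel

lemma exampleOne_first (j : Fin 5) :
    exampleOne j 0 = intVec (pentagonFirstNormSq j) (pentagonFirst j) := by
  fin_cases j <;>
    simp [exampleOne, triple, intVec, unitVec, pentagonFirst, pentagonFirstNormSq,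
      intCast_vec_three, invSqrt_one]

lemma exampleOne_second (j : Fin 5) :
    exampleOne j 1 = intVec (pentagonSecondNormSq j) (pentagonSecond j) := by
  fin_cases j <;>
    simp [exampleOne, triple, intVec, unitVec, pentagonSecond, pentagonSecondNormSq,
      intCast_vec_two, invSqrt_one]

def exampleOneThird : Fin 5 → Fin 2 → ℂ :=
  ![![1, ((√2 : ℝ) : ℂ)], ![1, 1], ![1, 0], ![1, -1], ![0, 1]]

def exampleOneThirdNormSq : Fin 5 → ℕ := ![3, 2, 1, 2, 1]

lemma exampleOneThirdNormSq_ne_zero : ∀ j, exampleOneThirdNormSq j ≠ 0 := by decide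

lemma exampleOne_third (j : Fin 5) :
    exampleOne j 2 = unitVec (exampleOneThirdNormSq j) (exampleOneThird j) := by
  fin_cases j <;>
    simp [exampleOne, triple, unitVec, exampleOneThird, exampleOneThirdNormSq, invSqrt_one]

lemma norm_exampleOne (j : Fin 5) (i : Fin 3) : ‖exampleOne j i‖ = 1 := by
  revert i
  refine forall_fin_three ?_ ?_ ?_
  · rw [exampleOne_first]
    exact norm_pentagonFirst j
  · rw [exampleOne_second]
    exact norm_pentagonSecond j
  · rw [exampleOne_third]
    refine norm_unitVec (exampleOneThirdNormSq_ne_zero j) ?_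
    fin_cases j <;> simp [exampleOneThird, exampleOneThirdNormSq] <;> norm_num

lemma inner_exampleOne_third (j k : Fin 5) (hjk : j ≠ k) :
    inner ℂ (exampleOne j 2) (exampleOne k 2) = 0 ↔
      colorOf 100002000020000010010 (vertexLabel j) (vertexLabel k) = 2 := by
  rw [exampleOne_third, exampleOne_third]
  refine (inner_unitVec_eq_zero_iff (exampleOneThirdNormSq_ne_zero j)
    (exampleOneThirdNormSq_ne_zero k) _ _).trans ?_
  have h1 : (1 : ℂ) + ((√2 : ℝ) : ℂ) ≠ 0 := by
    have : (1 : ℝ) + √2 ≠ 0 := by positivity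
    exact_mod_cast this
  have h2 : (1 : ℂ) + -((√2 : ℝ) : ℂ) ≠ 0 := by
    have : (1 : ℝ) + -√2 ≠ 0 := by
      have : (1 : ℝ) < √2 := Real.lt_sqrt_of_sq_lt (by norm_num)
      linarith
    exact_mod_cast this
  fin_cases j <;> fin_cases k <;> first
    | exact absurd rfl hjk
    | simp [exampleOneThird, colorOf_eq, vertexLabel, dotProduct, Fin.sum_univ_two, h1, h2]

lemma orthGraph_exampleOne : orthGraph exampleOne = orthogonalityGraphs 29 := by
  refine orthGraph_eq_orthogonalityGraphs (x := 100002000020000010010) rfl ?_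
  refine forall_fin_three (fun j k hjk => ?_) (fun j k hjk => ?_) inner_exampleOne_third
  · rw [exampleOne_first, exampleOne_first]
    exact inner_pentagonFirst j k hjk
  · rw [exampleOne_second, exampleOne_second]
    exact inner_pentagonSecond j k hjk

lemma not_LOCCDistinguishable_exampleOne : ¬ LOCCDistinguishable exampleOne := by
  have hne (j i) : exampleOne j i ≠ 0 := fun h => by
    have := norm_exampleOne j i
    rw [h, norm_zero] at this
    exact zero_ne_one this
  have hadj (p i : Fin 3) (j k : Fin 5) (hp : p ≠ i) (h : (orthGraph exampleOne p).Adj j k) :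
      inner ℂ (exampleOne j i) (exampleOne k i) ≠ 0 := fun h0 => by
    have h' : (orthGraph exampleOne i).Adj j k := ⟨h.ne, h0⟩
    rw [orthGraph_exampleOne] at h h'
    exact hp (Fin.ext (h.2.symm.trans h'.2))
  have hedge (p : Fin 3) (j k : Fin 5) (h : j ≠ k ∧
      colorOf 100002000020000010010 (vertexLabel j) (vertexLabel k) = p) :
      (orthGraph exampleOne p).Adj j k := by
    rw [orthGraph_exampleOne]
    exact h
  refine not_LOCCDistinguishable norm_exampleOne (fun i A => IsScaledUnitary A) (exampleOne 0)
    (fun p => (orthGraph exampleOne p).Adj) (fun p j k h => h.ne) (fun i => isScaledUnitary_one)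
    (fun i A hA => hA.act_ne_zero (hne 0 i))
    (fun i A hA p j k hp h => hA.inner_act_act_ne_zero (hadj p i j k hp h)) ?_
    (a := 0) (b := 1) (by decide)
    (fun i A hA => ⟨hA.act_ne_zero (hne 0 i), hA.act_ne_zero (hne 1 i)⟩)
  refine forall_fin_three (fun B h ht => ?_) (fun B h ht => ?_) (fun B h ht => ?_)
  · have e (j k : Fin 5) (hjk : j ≠ k ∧
        colorOf 100002000020000010010 (vertexLabel j) (vertexLabel k) = 0) := by
      have := h j k (hedge 0 j k hjk)
      rw [exampleOne_first, exampleOne_first] at this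
      exact (inner_act_intVec_eq_zero_iff (pentagonFirstNormSq_ne_zero j)
        (pentagonFirstNormSq_ne_zero k) B _ _).1 this
    have e03 := e 0 3 (by decide)
    have e32 := e 3 2 (by decide)
    have e21 := e 2 1 (by decide)
    have e14 := e 1 4 (by decide)
    have e04 := e 0 4 (by decide)
    simp only [pentagonFirst, Matrix.cons_val, intCast_vec_three, Int.cast_zero, Int.cast_one,
      Int.cast_neg] at e03 e32 e21 e14 e04
    exact isScaledUnitary_of_pentagon e03 e32 e21 e14 e04 ht
  · have e (j k : Fin 5) (hjk : j ≠ k ∧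
        colorOf 100002000020000010010 (vertexLabel j) (vertexLabel k) = 1) := by
      have := h j k (hedge 1 j k hjk)
      rw [exampleOne_second, exampleOne_second] at this
      exact (inner_act_intVec_eq_zero_iff (pentagonSecondNormSq_ne_zero j)
        (pentagonSecondNormSq_ne_zero k) B _ _).1 this
    have e01 := e 0 1 (by decide)
    have e34 := e 3 4 (by decide)
    simp only [pentagonSecond, Matrix.cons_val, intCast_vec_two, Int.cast_zero, Int.cast_one,
      Int.cast_neg] at e01 e34
    exact isScaledUnitary_of_two_bases e01 e34 ht
  · have e (j k : Fin 5) (hjk : j ≠ k ∧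
        colorOf 100002000020000010010 (vertexLabel j) (vertexLabel k) = 2) := by
      have := h j k (hedge 2 j k hjk)
      rw [exampleOne_third, exampleOne_third] at this
      exact (inner_act_unitVec_eq_zero_iff (exampleOneThirdNormSq_ne_zero j)
        (exampleOneThirdNormSq_ne_zero k) B _ _).1 this
    have e24 := e 2 4 (by decide)
    have e13 := e 1 3 (by decide)
    exact isScaledUnitary_of_two_bases e24 e13 ht

def exampleTwoThird : Fin 5 → Fin 3 → ℤ :=
  ![![1, 0, 0], ![1, 1, 0], ![1, 0, 1], ![1, -1, 0], ![1, 0, -1]]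

def exampleTwoThirdNormSq : Fin 5 → ℕ := ![1, 2, 2, 2, 2]

lemma exampleTwoThirdNormSq_ne_zero : ∀ j, exampleTwoThirdNormSq j ≠ 0 := by decide

lemma exampleTwo_first (j : Fin 5) :
    exampleTwo j 0 = intVec (pentagonFirstNormSq j) (pentagonFirst j) := by
  fin_cases j <;>
    simp [exampleTwo, triple, intVec, unitVec, pentagonFirst, pentagonFirstNormSq,
      intCast_vec_three, invSqrt_one]

lemma exampleTwo_second (j : Fin 5) :
    exampleTwo j 1 = intVec (pentagonSecondNormSq j) (pentagonSecond j) := by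
  fin_cases j <;>
    simp [exampleTwo, triple, intVec, unitVec, pentagonSecond, pentagonSecondNormSq,
      intCast_vec_two, invSqrt_one]

lemma exampleTwo_third (j : Fin 5) :
    exampleTwo j 2 = intVec (exampleTwoThirdNormSq j) (exampleTwoThird j) := by
  fin_cases j <;>
    simp [exampleTwo, triple, intVec, unitVec, exampleTwoThird, exampleTwoThirdNormSq,
      intCast_vec_three, invSqrt_one]

lemma norm_exampleTwo (j : Fin 5) (i : Fin 3) : ‖exampleTwo j i‖ = 1 := by
  revert i
  refine forall_fin_three ?_ ?_ ?_
  · rw [exampleTwo_first]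
    exact norm_pentagonFirst j
  · rw [exampleTwo_second]
    exact norm_pentagonSecond j
  · rw [exampleTwo_third]
    exact norm_intVec (exampleTwoThirdNormSq_ne_zero j) (by revert j; decide)

lemma orthGraph_exampleTwo : orthGraph exampleTwo = orthogonalityGraphs 29 := by
  refine orthGraph_eq_orthogonalityGraphs (x := 100002000020000010010) rfl ?_
  refine forall_fin_three (fun j k hjk => ?_) (fun j k hjk => ?_) (fun j k hjk => ?_)
  · rw [exampleTwo_first, exampleTwo_first]
    exact inner_pentagonFirst j k hjk
  · rw [exampleTwo_second, exampleTwo_second]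
    exact inner_pentagonSecond j k hjk
  · rw [exampleTwo_third, exampleTwo_third]
    refine (inner_intVec_eq_zero_iff (exampleTwoThirdNormSq_ne_zero j)
      (exampleTwoThirdNormSq_ne_zero k) _ _).trans ?_
    revert j k
    decide +kernel

/-- The signs of the four vectors `|0⟩ ± |1⟩ ± |2⟩`. -/
def signVec : Fin 4 → Fin 3 → ℤ := ![![1, 1, 1], ![1, 1, -1], ![1, -1, 1], ![1, -1, -1]]

/-- The measurement of the third party for `exampleTwo`: half the bras of the sign vectors. -/
def signMeasurement (o : Fin 4) : Matrix (Fin 3) (Fin 3) ℂ :=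
  Matrix.of ![fun y => (signVec o y : ℂ) / 2, 0, 0]

lemma signMeasurement_complete : ∑ o, (signMeasurement o)ᴴ * signMeasurement o = 1 := by
  ext x y
  fin_cases x <;> fin_cases y <;>
    simp [Fin.sum_univ_four, Matrix.mul_apply, Fin.sum_univ_three, signMeasurement, signVec,
      map_ofNat] <;>
    norm_num

lemma act_signMeasurement_eq_zero {o : Fin 4} {k : ℕ} {z : Fin 3 → ℤ} (h : signVec o ⬝ᵥ z = 0) :
    act (signMeasurement o) (intVec k z) = 0 := by
  have h' : ((signVec o ⬝ᵥ z : ℤ) : ℂ) = 0 := by rw [h, Int.cast_zero]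
  simp only [dotProduct, Fin.sum_univ_three, Int.cast_add, Int.cast_mul] at h'
  ext x
  fin_cases x
  · simp [intVec, unitVec, Matrix.mulVec, dotProduct, Fin.sum_univ_three, signMeasurement]
    linear_combination invSqrt k / 2 * h'
  · simp [signMeasurement, Matrix.mulVec]
  · simp [signMeasurement, Matrix.mulVec]

/-- The strategies after the outcomes of `signMeasurement`. -/
def signStrategy : Fin 4 → Strategy 3 5 :=
  ![.split 1 [0] (.answer 0) (.split 0 [1] (.answer 1) (.answer 2)),
    .split 0 [4] (.answer 4) (.split 1 [0] (.answer 0) (.answer 1)),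
    .split 0 [3] (.answer 3) (.split 1 [0] (.answer 0) (.answer 2)),
    .split 0 [0] (.answer 0) (.split 1 [3] (.answer 3) (.answer 4))]

lemma signStrategy_wins : ∀ o, (signStrategy o).wins
    (fun j => decide (signVec o ⬝ᵥ exampleTwoThird j ≠ 0))
    (fun i j k => decide (i ≠ 2 ∧ j ≠ k ∧
      colorOf 100002000020000010010 (vertexLabel j) (vertexLabel k) = i)) = true := by
  decide +kernel

lemma LOCCDistinguishable_exampleTwo : LOCCDistinguishable exampleTwo := by
  have hedge (i : Fin 3) (j k : Fin 5) (h : j ≠ k ∧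
      colorOf 100002000020000010010 (vertexLabel j) (vertexLabel k) = i) :
      inner ℂ (exampleTwo j i) (exampleTwo k i) = 0 := by
    have : (orthGraph exampleTwo i).Adj j k := by
      rw [orthGraph_exampleTwo]
      exact h
    exact this.2
  have hnext (o : Fin 4) := Strategy.exists_protocol (d := ![3, 2, 3]) (id : Fin 5 → Fin 5)
    (signStrategy o) (signStrategy_wins o)
    (φ := fun j => applyAt 2 (signMeasurement o) (exampleTwo j))
    (fun i j k h => by
      obtain ⟨hi, h⟩ := of_decide_eq_true h
      exact (congrArg₂ _ (applyAt_of_ne hi _ _) (applyAt_of_ne hi _ _)).trans (hedge i j k h))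
    (fun j hj => by
      rw [decide_eq_false_iff_not, not_not] at hj
      refine (productKet_eq_zero_iff _).2 ⟨2, ?_⟩
      refine (applyAt_self _ _ _).trans ?_
      rw [exampleTwo_third]
      exact act_signMeasurement_eq_zero hj)
  exact .of_measurement norm_exampleTwo (p := 2) signMeasurement_complete hnext

end LocalDiscrimination

end

open LocalDiscrimination in
theorem theorem10 :
    -- there are exactly 30 orthogonality graphs, the 26th and the 30th being the two special ones
    (∃ Γ : Fin 30 → ColoredGraph 3 5,
      Γ 25 = starMatchingGraph ∧ Γ 29 = pentagonGraph ∧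
      (∀ r s, (Γ r).Isomorphic (Γ s) → r = s) ∧
      (∀ G : ColoredGraph 3 5,
        IsOrthGraphWithVector G ![5, 3, 2] ↔ ∃ r, G.Isomorphic (Γ r))) ∧
    -- outside the two special graphs the states can be perfectly distinguished
    (∀ (d : Fin 3 → ℕ) (φ : LocalVectors d 5), IsOPS φ → orthVector φ = ![5, 3, 2] →
      ¬ (orthGraph φ).Isomorphic starMatchingGraph →
      ¬ (orthGraph φ).Isomorphic pentagonGraph →
      LOCCDistinguishable φ) ∧
    -- the first special graph is a genuine exception
    (∃ (d : Fin 3 → ℕ) (φ : LocalVectors d 5), IsOPS φ ∧ orthVector φ = ![5, 3, 2] ∧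
      orthGraph φ = starMatchingGraph ∧ ¬ LOCCDistinguishable φ) ∧
    -- for the second special graph both behaviours occur
    (IsOPS exampleOne ∧ orthVector exampleOne = ![5, 3, 2] ∧
      orthGraph exampleOne = pentagonGraph ∧ ¬ LOCCDistinguishable exampleOne) ∧
    (IsOPS exampleTwo ∧ orthVector exampleTwo = ![5, 3, 2] ∧
      orthGraph exampleTwo = pentagonGraph ∧ LOCCDistinguishable exampleTwo) := by
  refine ⟨⟨orthogonalityGraphs, orthogonalityGraphs_star, orthogonalityGraphs_pentagon,
      fun r s h => orthogonalityGraphs_injective h, isOrthGraphWithVector_iff⟩,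
    fun d φ hφ hv hs hp => distinguishable_of_not_isomorphic hφ hv hs hp,
    ⟨_, starExample, ?_, ?_, ?_, not_LOCCDistinguishable_starExample⟩,
    ⟨?_, ?_, ?_, not_LOCCDistinguishable_exampleOne⟩,
    ⟨?_, ?_, ?_, LOCCDistinguishable_exampleTwo⟩⟩
  · exact (isOPS_and_orthVector norm_starExample orthGraph_starExample).1
  · exact (isOPS_and_orthVector norm_starExample orthGraph_starExample).2
  · rw [orthGraph_starExample, orthogonalityGraphs_star]
  · exact (isOPS_and_orthVector norm_exampleOne orthGraph_exampleOne).1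
  · exact (isOPS_and_orthVector norm_exampleOne orthGraph_exampleOne).2
  · rw [orthGraph_exampleOne, orthogonalityGraphs_pentagon]
  · exact (isOPS_and_orthVector norm_exampleTwo orthGraph_exampleTwo).1
  · exact (isOPS_and_orthVector norm_exampleTwo orthGraph_exampleTwo).2
  · rw [orthGraph_exampleTwo, orthogonalityGraphs_pentagon]
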